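/- **Setting.** A numerical semigroup is a submonoid $S$ of $(\mathbb N,+)$ with finite complement; the elements of $\mathbb N\setminus S$ are its gaps. An integer $x\notin S$ is the Frobenius number of $S$ if $x+s\in S$ for all $s\in\mathbb N\setminus\{0\}$, and a pseudo-Frobenius number of $S$ if $x+s\in S$ for all $s\in S\setminus\{0\}$. $S$ is irreducible if it is not the intersection of two numerical semigroups properly containing it. For a set $PF=\{g_1<\dots<g_n\}$, $n\ge 1$, of positive integers, $\mathcal S(PF)$ is the set of numerical semigroups whose set of pseudo-Frobenius numbers is $PF$. Write $f=g_n$, $[a..b]=\{x\in\mathbb Z: a\le x\le b\}$, $\mathrm{Pos}(X)$ for the set of positive elements of $X$, $\mathrm{Div}(X)$ for the set of positive divisors of elements of $X$, and $a-X=\{a-x:x\in X\}$, $X-a=\{x-a:x\in X\}$, $a+X=\{a+x:x\in X\}$. The following procedures (with $PF$ fixed, $G,E$ finite sets of integers) may return a special value *fail*. * $\mathrm{StartingForcedGaps}$: for $2\le i\le n$ let $C_i$ be the set of elements $\le g_i+1$ of the numerical semigroup generated by $\{g_1,\dots,g_{i-1}\}\cup[g_i+1..g_i+g_1]$. Let $D=\mathrm{Div}\big([1..n]\cup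 PF\cup\bigcup_{i=2}^n \mathrm{Pos}(g_i-C_i)\big)$. If $\mathrm{Pos}((PF-x)\setminus D)=\emptyset$ for some $x\in D\setminus PF$, return *fail*; otherwise return $D$. * $\mathrm{FurtherForcedGaps}(G,E)$: let $N=\mathrm{Div}(\mathrm{Pos}(\{g-e: g\in G,e\in E\}))$. Return $G\cup N$ if $E\cap N=\emptyset$, and *fail* otherwise. * $\mathrm{FurtherForcedElements}(G,E)$: let $m$ be the least positive integer not in $G$ and $B=(f-[1..m-1])\setminus PF$. For $x\in G$ let $P_x=\{p\in PF: p-x\ge 0,\ p-x\notin G\}$, and let $A_1=\{p-x: x\in G,\ P_x=\{p\}\}$. Let $A_2$ be the set of $x\in[1..f-1]\setminus(G\cup E\cup A_1)$ with $\mathrm{Pos}((PF-x)\setminus G)=\emptyset$. Put $N=E\cup A_1\cup A_2\cup B$. Return $N$ if $G\cap N=\emptyset$, and *fail* otherwise. * $\mathrm{SimpleForcedIntegers}(G,E)$: repeat the following. Compute $G'=\mathrm{FurtherForcedGaps}(G,E)$; if it is *fail*, return *fail*. Compute $E'=\mathrm{FurtherForcedElements}(G',E)$; if it is *fail*, return *fail*.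 If $(G',E')=(G,E)$, return $(G,E)$; otherwise replace $(G,E)$ by $(G',E')$. * $\mathrm{NonAdmissible}(G,E)$: start with $A=\emptyset$, $T=[1..f]\setminus(G\cup E)$. While $T\ne\emptyset$: let $v=\min T$ and $R=\mathrm{SimpleForcedIntegers}(G,E\cup\{v\})$; if $R$ is *fail*, replace $T$ by $T\setminus\{v\}$; if $R=(R_1,R_2)$, replace $A$ by $A\cup R_2$ and then $T$ by $T\setminus A$. Return $[1..f]\setminus A$. * $\mathrm{ForcedIntegers}$: if $n=1$, return $(\mathrm{Div}(\{f\}),\{0,f+1\})$. Otherwise compute $D=\mathrm{StartingForcedGaps}$ and then $\mathrm{SimpleForcedIntegers}(D,\emptyset)$; if one of them is *fail*, return *fail*. Let $(G,E)$ be the result. If $G\cup E$ is an interval of integers, return $(G,E)$; otherwise return $\mathrm{SimpleForcedIntegers}(G\cup\mathrm{NonAdmissible}(G,E),E)$. * $\mathrm{EndingCondition}(G,E)$, which may add numerical semigroups to a global container $\Sigma$: let $U=[1..f]\setminus(G\cup E)$. If $U=\emptyset$, and no $x\in G\setminus PF$ satisfies $(x+(E\setminus\{0\}))\cap G=\emptyset$,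 add to $\Sigma$ the numerical semigroup with set of gaps $G$. If $U$ has exactly one element: (a) if $G$ is the set of gaps of a numerical semigroup and no $x\in G\setminus PF$ satisfies $(x+((E\cup U)\setminus\{0\}))\cap G=\emptyset$, add that semigroup to $\Sigma$; (b) if $G\cup U$ is the set of gaps of a numerical semigroup and no $x\in (G\cup U)\setminus PF$ satisfies $(x+(E\setminus\{0\}))\cap (G\cup U)=\emptyset$, add that semigroup to $\Sigma$. If $U$ has more than one element, do nothing. * $\mathrm{Explore}(G,E)$ (recursive depth-first exploration): let $U=[1..f]\setminus(G\cup E)$, $H=G$. While $|U|>1$: let $v=\min U$ and $L=\mathrm{SimpleForcedIntegers}(H,E\cup\{v\})$. If $L$ is *fail*, compute $R=\mathrm{SimpleForcedIntegers}(H\cup\{v\},E)$ and leave the loop if $R$ is *fail* or its two components intersect. If $L=(L_1,L_2)$, call $\mathrm{Explore}(L_1,L_2)$. Then (unless the loop was left) replace $H$ by $H\cup\{v\}$ and $U$ by $U\setminus\{v\}$. After the loop, if $|U|\le 1$, call $\mathrm{EndingCondition}(H,E)$. * **Main algorithm** with input $PF$: if $n=1$, or $n=2$ and $g_1=g_2/2$,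 return the set of irreducible numerical semigroups with Frobenius number $f$. Otherwise, if $g_n-g_{n-1}>g_1$, return $\emptyset$. Otherwise compute $\mathrm{ForcedIntegers}$; if it is *fail*, return $\emptyset$. Otherwise, with $(G,E)$ its value, set $\Sigma=\emptyset$, call $\mathrm{Explore}(G,E)$ and return $\Sigma$. **Theorem.** Let $PF=\{g_1<\dots<g_n\}$, $n\ge1$, be a finite set of positive integers, where $g_1$ is odd if $n=1$. Then the main algorithm with input $PF$ terminates (never asking for a numerical semigroup with a set of gaps that no numerical semigroup has), and its output is exactly $\mathcal S(PF)$. -/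

import Mathlib

/-- A numerical semigroup: a submonoid of `(ℕ, +)` with finite complement. -/
structure NumericalSemigroup extends AddSubmonoid ℕ where
  finite_compl : (carrierᶜ).Finite

namespace NumericalSemigroup

/-- The elements of `S`, seen as integers. -/
def elements (S : NumericalSemigroup) : Set ℤ :=
  {x | ∃ n : ℕ, n ∈ S.toAddSubmonoid ∧ (n : ℤ) = x}

/-- The gaps of `S`: the nonnegative integers outside `S`. -/
def gaps (S : NumericalSemigroup) : Set ℤ :=
  {x | 0 ≤ x ∧ x ∉ S.elements}

/-- `x` is the Frobenius number of `S`. -/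
def IsFrobeniusNumber (S : NumericalSemigroup) (x : ℤ) : Prop :=
  x ∉ S.elements ∧ ∀ n : ℕ, n ≠ 0 → x + n ∈ S.elements

/-- The set of pseudo-Frobenius numbers of `S`. -/
def pseudoFrobeniusNumbers (S : NumericalSemigroup) : Set ℤ :=
  {x | x ∉ S.elements ∧ ∀ s ∈ S.elements, s ≠ 0 → x + s ∈ S.elements}

/-- `S` is irreducible: it is not the intersection of two numerical semigroups that properly
contain it. -/
def IsIrreducible (S : NumericalSemigroup) : Prop :=
  ¬ ∃ T U : NumericalSemigroup, S.elements ⊂ T.elements ∧ S.elements ⊂ U.elements ∧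
    S.elements = T.elements ∩ U.elements

/-- The set of numerical semigroups whose set of pseudo-Frobenius numbers is `PF`. -/
def withPseudoFrobeniusNumbers (PF : Finset ℤ) : Set NumericalSemigroup :=
  {S | S.pseudoFrobeniusNumbers = (PF : Set ℤ)}

theorem eq_of_elements_eq {S T : NumericalSemigroup} (h : S.elements = T.elements) : S = T := by
  have key : S.toAddSubmonoid = T.toAddSubmonoid := by
    ext n
    have h1 : (n : ℤ) ∈ S.elements ↔ (n : ℤ) ∈ T.elements := by rw [h]
    simpa [elements] using h1
  cases S
  cases T
  simp only at key
  subst key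
  rfl

theorem finite_irreducible (f : ℤ) :
    {S : NumericalSemigroup | S.IsIrreducible ∧ S.IsFrobeniusNumber f}.Finite := by
  refine Set.Finite.of_finite_image (f := gaps)
    (((Set.finite_Icc (0 : ℤ) f).finite_subsets).subset ?_) ?_
  · rintro _ ⟨S, ⟨-, hS⟩, rfl⟩ x ⟨hx0, hx⟩
    refine ⟨hx0, ?_⟩
    by_contra hlt
    push Not at hlt
    have h1 := hS.2 (x - f).toNat (by omega)
    rw [Int.toNat_of_nonneg (by omega)] at h1
    exact hx (by simpa using h1)
  · intro S _ T _ hST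
    apply eq_of_elements_eq
    ext x
    have h1 : x ∈ S.gaps ↔ x ∈ T.gaps := by rw [hST]
    simp only [gaps, Set.mem_ofPred_eq] at h1
    by_cases hx : 0 ≤ x
    · simp only [hx, true_and] at h1
      exact not_iff_not.mp h1
    · constructor <;> rintro ⟨n, -, rfl⟩ <;> exact absurd (Int.natCast_nonneg n) hx

end NumericalSemigroup

namespace PFAlgorithm

/-- The result of a procedure that may return the value `fail`. -/
inductive OrFail (α : Type) where
  | fail : OrFail α
  | ok : α → OrFail α

/-! Sorted duplicate-free lists of integers are finite sets of integers.  A procedure that contains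
a loop or a recursion takes an additional argument `k`, a bound on the depth of the computation in
terms of successive loop passes and nested calls, and has values in an `Option` type: `none` means
that it did not come to its end within this bound, or that a call it made is undefined (there is no
numerical semigroup with the prescribed set of gaps). -/

/-- The positive integers of `X`. -/
noncomputable def posInt (X : Finset ℤ) : Finset ℤ := X.filter (fun x => 0 < x)

/-- The positive divisors of the positive integers in `X`. -/
noncomputable def divisors (X : Finset ℤ) : Finset ℤ :=
  (posInt X).biUnion fun p => (Finset.Icc 1 p).filter (fun d => d ∣ p)

/-- `PF[i]`, the `i`-th element of `PF` in increasing order, `1 ≤ i ≤ PF.card`. -/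
noncomputable def entry (PF : Finset ℤ) (i : ℕ) : ℤ := (PF.sort (· ≤ ·)).getD (i - 1) 0

/-- The maximum of `PF`. -/
noncomputable def frob (PF : Finset ℤ) : ℤ := entry PF PF.card

/-- The translate `X - x`. -/
noncomputable def translate (X : Finset ℤ) (x : ℤ) : Finset ℤ := X.image (fun f => f - x)

/-- The differences `a - X`. -/
noncomputable def subFrom (a : ℤ) (X : Finset ℤ) : Finset ℤ := X.image (fun x => a - x)

/-- The least element of `X` (for nonempty `X`). -/
noncomputable def minimum (X : Finset ℤ) : ℤ := X.min.untopD 0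

/-- The semigroup generated by `elts` and `[f+1 .. f+Minimum(PosInt(elts))]`: the least numerical
semigroup that contains `elts` and has Frobenius number at most `f`. -/
def closure (elts : Finset ℤ) (f : ℤ) : AddSubmonoid ℤ :=
  AddSubmonoid.closure ((elts ∪ Finset.Icc (f + 1) (f + minimum (posInt elts)) : Finset ℤ) : Set ℤ)

open Classical in
/-- The elements of `closure elts f` that are not greater than `f + 1`. -/
noncomputable def closureElements (elts : Finset ℤ) (f : ℤ) : Finset ℤ :=
  (Finset.Icc 0 (f + 1)).filter (fun x => x ∈ closure elts f)

/-- The starting forced gaps. -/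
noncomputable def startingForcedGaps (PF : Finset ℤ) : OrFail (Finset ℤ) :=
  let diffs : Finset ℤ := (Finset.Icc 2 PF.card).biUnion fun i =>
    posInt (subFrom (entry PF i)
      (closureElements ((Finset.Icc 1 (i - 1)).image (entry PF)) (entry PF i)))
  let fg : Finset ℤ := divisors ((Finset.Icc 1 (PF.card : ℤ) ∪ PF) ∪ diffs)
  if ∃ x ∈ fg \ PF, posInt (translate PF x \ fg) = ∅ then .fail else .ok fg

noncomputable def furtherForcedGaps (fg fe : Finset ℤ) : OrFail (Finset ℤ) :=
  let ng : Finset ℤ := divisors (posInt (fg.biUnion fun g => subFrom g fe))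
  if fe ∩ ng = ∅ then .ok (fg ∪ ng) else .fail

/-- The least positive integer that is not in `fg`. -/
noncomputable def leastNonGap (fg : Finset ℤ) : ℕ := sInf {n : ℕ | 0 < n ∧ (n : ℤ) ∉ fg}

noncomputable def furtherForcedElements (PF fg fe : Finset ℤ) : OrFail (Finset ℤ) :=
  let be : Finset ℤ := subFrom (frob PF) (Finset.Icc 1 ((leastNonGap fg : ℤ) - 1)) \ PF
  let filt : ℤ → Finset ℤ := fun x => PF.filter (fun f => ¬ (f - x ∈ fg ∨ f - x < 0))
  let ee₁ : Finset ℤ := (fg.filter (fun x => (filt x).card = 1)).biUnion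
    fun x => translate (filt x) x
  let candidates : Finset ℤ := Finset.Icc 1 (frob PF - 1) \ (fg ∪ (fe ∪ ee₁))
  let ee : Finset ℤ := ee₁ ∪ candidates.filter (fun x => posInt (translate PF x \ fg) = ∅)
  let ne : Finset ℤ := fe ∪ ee ∪ be
  if fg ∩ ne = ∅ then .ok ne else .fail

noncomputable def simpleForcedIntegers (PF : Finset ℤ) :
    ℕ → Finset ℤ → Finset ℤ → Option (OrFail (Finset ℤ × Finset ℤ))
  | 0, _, _ => none
  | k + 1, fg, fe =>
    match furtherForcedGaps fg fe with
    | .fail => some .fail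
    | .ok gaps =>
      match furtherForcedElements PF gaps fe with
      | .fail => some .fail
      | .ok elts =>
        if gaps ≠ fg ∨ elts ≠ fe then simpleForcedIntegers PF k gaps elts
        else some (.ok (gaps, elts))

/-- The `while` loop of `nonAdmissible`; its value is the final value of `admissible`. -/
noncomputable def nonAdmissibleLoop (PF fg fe : Finset ℤ) :
    ℕ → Finset ℤ → Finset ℤ → Option (Finset ℤ)
  | 0, _, _ => none
  | k + 1, admissible, totest =>
    if totest = ∅ then some admissible
    else
      let v : ℤ := minimum totest
      match simpleForcedIntegers PF k fg (fe ∪ {v}) with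
      | none => none
      | some .fail => nonAdmissibleLoop PF fg fe k admissible (totest \ {v})
      | some (.ok pnfce) =>
        nonAdmissibleLoop PF fg fe k (admissible ∪ pnfce.2) (totest \ (admissible ∪ pnfce.2))

/-- The integers in `[1 .. frob]` that are neither in `fg` nor in `fe`. -/
noncomputable def freeIntegers (PF fg fe : Finset ℤ) : Finset ℤ := Finset.Icc 1 (frob PF) \ (fg ∪ fe)

noncomputable def nonAdmissible (PF : Finset ℤ) (k : ℕ) (fg fe : Finset ℤ) : Option (Finset ℤ) :=
  match nonAdmissibleLoop PF fg fe k ∅ (freeIntegers PF fg fe) with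
  | none => none
  | some admissible => some (Finset.Icc 1 (frob PF) \ admissible)

/-- `X` is an interval of integers. -/
def IsRange (X : Finset ℤ) : Prop := ∃ a b : ℤ, X = Finset.Icc a b

open Classical in
noncomputable def forcedIntegers (PF : Finset ℤ) (k : ℕ) :
    Option (OrFail (Finset ℤ × Finset ℤ)) :=
  if PF.card = 1 then some (.ok (divisors {frob PF}, {0, frob PF + 1}))
  else
    match startingForcedGaps PF with
    | .fail => some .fail
    | .ok sfg =>
      match simpleForcedIntegers PF k sfg ∅ with
      | none => none
      | some .fail => some .fail
      | some (.ok fints) =>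
        if IsRange (fints.1 ∪ fints.2) then some (.ok fints)
        else
          match nonAdmissible PF k fints.1 fints.2 with
          | none => none
          | some nad => simpleForcedIntegers PF k ((nad \ fints.1) ∪ fints.1) fints.2

/-- There is a numerical semigroup whose set of gaps is `X`. -/
def RepresentsGaps (X : Finset ℤ) : Prop := ∃ S : NumericalSemigroup, S.gaps = (X : Set ℤ)

open Classical in
/-- The (unique) numerical semigroup whose set of gaps is `X`; undefined if there is none. -/
noncomputable def numericalSemigroupByGaps (X : Finset ℤ) : Option NumericalSemigroup :=
  if h : RepresentsGaps X then some h.choose else none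

open Classical in
/-- Adds the numerical semigroup with set of gaps `X` to the container `semigroups`. -/
noncomputable def addByGaps (X : Finset ℤ) (semigroups : Finset NumericalSemigroup) :
    Option (Finset NumericalSemigroup) :=
  match numericalSemigroupByGaps X with
  | none => none
  | some S => some (insert S semigroups)

/-- No `x` in `X` satisfies `(x + (E \ {0})) ∩ G = ∅`. -/
def NoneMaximal (X E G : Finset ℤ) : Prop :=
  ¬ ∃ x ∈ X, ((E \ {0}).image fun s => x + s) ∩ G = ∅

open Classical in
noncomputable def endingCondition (PF g e : Finset ℤ) (semigroups : Finset NumericalSemigroup) :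
    Option (Finset NumericalSemigroup) :=
  let free : Finset ℤ := freeIntegers PF g e
  if free.card = 0 then
    if NoneMaximal (g \ PF) e g then addByGaps g semigroups else some semigroups
  else if free.card = 1 then
    let first : Option (Finset NumericalSemigroup) :=
      if RepresentsGaps g ∧ NoneMaximal (g \ PF) (e ∪ free) g
      then addByGaps g semigroups else some semigroups
    match first with
    | none => none
    | some semigroups' =>
      if RepresentsGaps (g ∪ free) ∧ NoneMaximal ((g ∪ free) \ PF) e (g ∪ free)
      then addByGaps (g ∪ free) semigroups' else some semigroups'
  else some semigroups

/-- The `while` loop of the recursive exploration of the node `(fg, fe)`, followed by the call of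
`endingCondition`, with current values `nfg` and `currentfree`.  The recursive call explores the
node `left` from the start, that is, with its first component as `nfg` and its free integers as
`currentfree`.  After a `break`, `currentfree` has more than one element, and nothing else is
done. -/
noncomputable def exploreLoop (PF : Finset ℤ) :
    ℕ → Finset ℤ → Finset ℤ → Finset ℤ → Finset NumericalSemigroup →
      Option (Finset NumericalSemigroup)
  | 0, _, _, _, _ => none
  | k + 1, nfg, fe, currentfree, semigroups =>
    if 1 < currentfree.card then
      let v : ℤ := minimum currentfree
      match simpleForcedIntegers PF k nfg (fe ∪ {v}) with
      | none => none
      | some .fail =>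
        match simpleForcedIntegers PF k (nfg ∪ {v}) fe with
        | none => none
        | some .fail => some semigroups
        | some (.ok right) =>
          if right.1 ∩ right.2 ≠ ∅ then some semigroups
          else exploreLoop PF k (nfg ∪ {v}) fe (currentfree \ {v}) semigroups
      | some (.ok left) =>
        match exploreLoop PF k left.1 left.2 (freeIntegers PF left.1 left.2) semigroups with
        | none => none
        | some semigroups' => exploreLoop PF k (nfg ∪ {v}) fe (currentfree \ {v}) semigroups'
    else endingCondition PF nfg fe semigroups

noncomputable def recursiveDepthFirstExploreTree (PF : Finset ℤ) (k : ℕ) (fg fe : Finset ℤ)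
    (semigroups : Finset NumericalSemigroup) : Option (Finset NumericalSemigroup) :=
  exploreLoop PF k fg fe (freeIntegers PF fg fe) semigroups

/-- The irreducible numerical semigroups with Frobenius number `f`. -/
noncomputable def irreducibleNumericalSemigroupsWithFrobeniusNumber (f : ℤ) :
    Finset NumericalSemigroup :=
  (NumericalSemigroup.finite_irreducible f).toFinset

/-- The main algorithm, run with depth bound `k`. -/
noncomputable def numericalSemigroupsWithPseudoFrobeniusNumbers (PF : Finset ℤ) (k : ℕ) :
    Option (Finset NumericalSemigroup) :=
  if PF.card = 1 ∨ (PF.card = 2 ∧ 2 * entry PF 1 = entry PF 2) then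
    some (irreducibleNumericalSemigroupsWithFrobeniusNumber (frob PF))
  else if entry PF PF.card - entry PF (PF.card - 1) > entry PF 1 then some ∅
  else
    match forcedIntegers PF k with
    | none => none
    | some .fail => some ∅
    | some (.ok root) => recursiveDepthFirstExploreTree PF k root.1 root.2 ∅

/-- The main algorithm with input `PF` terminates and its output is `out`: every run with a
sufficiently large bound ends with `out`. -/
def Returns (PF : Finset ℤ) (out : Finset NumericalSemigroup) : Prop :=
  ∃ N : ℕ, ∀ k : ℕ, N ≤ k → numericalSemigroupsWithPseudoFrobeniusNumbers PF k = some out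

end PFAlgorithm

/-!
The algorithm manipulates pairs `(G, E)` of finite sets, thought of as integers forced to be gaps
and integers forced to be elements.  A numerical semigroup `S` with pseudo-Frobenius numbers `PF`
is `Compatible` with `(G, E)` if `G` consists of gaps and `E` of elements of `S`.

The only property of pseudo-Frobenius numbers behind the forced integers is that every gap `x` of
`S` lies below some `p` in `PF`, that is, `p - x ∈ S` (`exists_mem_sub_mem`).  It makes each
procedure sound: a compatible `S` stays compatible with the enlarged pair, and `fail` means that
there is none (`furtherForcedGaps_cases`, `furtherForcedElements_cases`,
`startingForcedGaps_cases`).  All pairs stay within `[1 .. f]` and `[0 .. f]`, so that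
`simpleForcedIntegers` becomes stationary, at a pair with `G - E` in `G` as far as positive
(`simpleForcedIntegers_cases`).  For such a stable pair, a compatible semigroup contains at least
one undecided integer, if there are any; this is why `nonAdmissible` is sound even though it also
returns the members of `E` when no undecided integer is admissible
(`Compatible.exists_mem_freeIntegers`, `exists_nonAdmissible_eq`).

The exploration splits the compatible semigroups according to the least undecided integer `v`
(`compatible_iff_or`), hence adds exactly the compatible ones (`exists_exploreLoop_eq`).  At a leaf
every integer is decided.  If the pair is stable, the complement of `G` is closed under addition
(`IsStable.representsGaps`), so the request for a semigroup with set of gaps `G` is legitimate.  The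
final test says that all maximal gaps belong to `PF`; conversely each member of `PF` is a maximal
gap since the differences of `PF` are among the starting forced gaps (`noneMaximal_iff`).

The two special inputs amount to the characterization of irreducible numerical semigroups by their
pseudo-Frobenius numbers (`isIrreducible_and_isFrobeniusNumber_iff`), and the early return of the
empty set is justified by `exists_mem_ge_sub`.
-/

/-! ### Elements, gaps and pseudo-Frobenius numbers -/

namespace NumericalSemigroup

variable {S : NumericalSemigroup}

theorem zero_mem_elements (S : NumericalSemigroup) : (0 : ℤ) ∈ S.elements :=
  ⟨0, S.toAddSubmonoid.zero_mem, rfl⟩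

theorem nonneg_of_mem_elements {x : ℤ} (hx : x ∈ S.elements) : 0 ≤ x := by
  obtain ⟨n, -, rfl⟩ := hx
  exact Int.natCast_nonneg n

theorem add_mem_elements {x y : ℤ} (hx : x ∈ S.elements) (hy : y ∈ S.elements) :
    x + y ∈ S.elements := by
  obtain ⟨m, hm, rfl⟩ := hx
  obtain ⟨n, hn, rfl⟩ := hy
  exact ⟨m + n, S.toAddSubmonoid.add_mem hm hn, by push_cast; rfl⟩

theorem mul_mem_elements {x k : ℤ} (hx : x ∈ S.elements) (hk : 0 ≤ k) : k * x ∈ S.elements := by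
  obtain ⟨m, hm, rfl⟩ := hx
  lift k to ℕ using hk
  exact ⟨k * m, by simpa using S.toAddSubmonoid.nsmul_mem hm k, by push_cast; rfl⟩

theorem mem_elements_of_notMem_gaps {x : ℤ} (h0 : 0 ≤ x) (hx : x ∉ S.gaps) : x ∈ S.elements := by
  by_contra h
  exact hx ⟨h0, h⟩

theorem pos_of_mem_gaps {x : ℤ} (hx : x ∈ S.gaps) : 0 < x := by
  rcases hx.1.lt_or_eq with h | rfl
  · exact h
  · exact absurd S.zero_mem_elements hx.2

theorem eq_of_gaps_eq {S T : NumericalSemigroup} (h : S.gaps = T.gaps) : S = T := by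
  apply eq_of_elements_eq
  ext x
  have h1 : x ∈ S.gaps ↔ x ∈ T.gaps := by rw [h]
  by_cases hx : 0 ≤ x
  · exact not_iff_not.mp (by simpa [gaps, hx] using h1)
  · exact iff_of_false (fun h => hx (nonneg_of_mem_elements h))
      (fun h => hx (nonneg_of_mem_elements h))

theorem exists_forall_gt_mem_elements (S : NumericalSemigroup) :
    ∃ B : ℤ, ∀ x, B < x → x ∈ S.elements := by
  obtain ⟨b, hb⟩ := S.finite_compl.bddAbove
  refine ⟨b, fun x hx => ?_⟩
  lift x to ℕ using by omega
  refine ⟨x, ?_, rfl⟩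
  by_contra h
  have := hb (a := x) h
  omega

/-- Every integer outside `S` lies below a pseudo-Frobenius number in the order
`x ≤ y ↔ y - x ∈ S`. -/
theorem exists_pseudoFrobenius_sub_mem {x : ℤ} (hx : x ∉ S.elements) :
    ∃ q ∈ S.pseudoFrobeniusNumbers, q - x ∈ S.elements := by
  obtain ⟨B, hB⟩ := S.exists_forall_gt_mem_elements
  obtain ⟨q, ⟨hq1, hq2⟩, hmax⟩ := Int.exists_greatest_of_bdd
    (P := fun y => y ∉ S.elements ∧ y - x ∈ S.elements)
    ⟨B, fun z hz => by by_contra h; exact hz.1 (hB z (by omega))⟩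
    ⟨x, hx, by simpa using S.zero_mem_elements⟩
  refine ⟨q, ⟨hq1, fun s hs hs0 => ?_⟩, hq2⟩
  by_contra h
  have h1 := hmax (q + s) ⟨h, by
    have := add_mem_elements hq2 hs
    rwa [show q - x + s = q + s - x by ring] at this⟩
  have := nonneg_of_mem_elements hs
  omega

theorem mem_gaps_of_dvd {x d : ℤ} (hx : x ∈ S.gaps) (hd : 0 ≤ d) (hdx : d ∣ x) : d ∈ S.gaps := by
  refine ⟨hd, fun h => hx.2 ?_⟩
  obtain ⟨c, rfl⟩ := hdx
  have h0 := pos_of_mem_gaps hx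
  have hc : 0 ≤ c := by
    by_contra hc
    nlinarith
  rw [mul_comm]
  exact mul_mem_elements h hc

theorem sub_mem_gaps {g e : ℤ} (hg : g ∈ S.gaps) (he : e ∈ S.elements) (h : 0 ≤ g - e) :
    g - e ∈ S.gaps :=
  ⟨h, fun h1 => hg.2 (by simpa using add_mem_elements h1 he)⟩

theorem IsFrobeniusNumber.mem_of_lt {f x : ℤ} (hf : S.IsFrobeniusNumber f) (hx : f < x) :
    x ∈ S.elements := by
  have := hf.2 (x - f).toNat (by omega)
  rwa [Int.toNat_of_nonneg (by omega), add_sub_cancel] at this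

/-! ### Irreducible numerical semigroups -/

/-- Adjoining a pseudo-Frobenius number `h` whose double belongs to `S` gives a numerical
semigroup. -/
theorem exists_elements_eq_insert {h : ℤ} (h0 : 0 ≤ h) (hPF : h ∈ S.pseudoFrobeniusNumbers)
    (h2 : h + h ∈ S.elements) : ∃ T : NumericalSemigroup, T.elements = insert h S.elements := by
  have hadd : ∀ x ∈ S.elements, h + x ∈ insert h S.elements := by
    intro x hx
    by_cases hx0 : x = 0
    · simp [hx0]
    · exact Or.inr (hPF.2 x hx hx0)
  refine ⟨⟨⟨⟨{n : ℕ | (n : ℤ) ∈ insert h S.elements}, ?_⟩, ?_⟩, ?_⟩, ?_⟩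
  · intro a b ha hb
    simp only [Set.mem_ofPred_eq] at ha hb ⊢
    push_cast
    rcases ha with ha | ha <;> rcases hb with hb | hb
    · rw [ha, hb]; exact Or.inr h2
    · rw [ha]; exact hadd _ hb
    · rw [hb, add_comm]; exact hadd _ ha
    · exact Or.inr (add_mem_elements ha hb)
  · exact Or.inr S.zero_mem_elements
  · refine S.finite_compl.subset fun n hn hnS => hn (Or.inr ⟨n, hnS, rfl⟩)
  · ext x
    constructor
    · rintro ⟨n, hn, rfl⟩
      exact hn
    · intro hx
      have hx0 : 0 ≤ x := hx.elim (fun e => e ▸ h0) nonneg_of_mem_elements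
      lift x to ℕ using hx0
      exact ⟨x, hx, rfl⟩

theorem IsFrobeniusNumber.mem_pseudoFrobeniusNumbers {f : ℤ} (hf : S.IsFrobeniusNumber f) :
    f ∈ S.pseudoFrobeniusNumbers := by
  refine ⟨hf.1, fun s hs hs0 => hf.mem_of_lt ?_⟩
  have := nonneg_of_mem_elements hs
  omega

/-- In an irreducible numerical semigroup with Frobenius number `f`, the reflection `x ↦ f - x`
maps the gaps other than `f / 2` into the semigroup: otherwise both `f` and the greatest exception
could be adjoined. -/
theorem IsIrreducible.sub_mem {f : ℤ} (hS : S.IsIrreducible) (hf : S.IsFrobeniusNumber f)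
    (hf0 : 0 < f) {x : ℤ} (hx : x ∉ S.elements) (hxf : 2 * x ≠ f) : f - x ∈ S.elements := by
  by_contra hfx
  -- Both `x` and `f - x` are exceptions, so the greatest one exceeds `f / 2`.
  obtain ⟨h, ⟨hh1, hh2, hh3⟩, hmax⟩ := Int.exists_greatest_of_bdd
    (P := fun y => y ∉ S.elements ∧ f - y ∉ S.elements ∧ 2 * y ≠ f)
    ⟨f, fun z hz => by by_contra h; exact hz.1 (hf.mem_of_lt (by omega))⟩
    ⟨x, hx, hfx, hxf⟩
  have hlarge := hmax (f - h) ⟨hh2, by simpa using hh1, by omega⟩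
  have hPF : h ∈ S.pseudoFrobeniusNumbers := by
    refine ⟨hh1, fun s hs hs0 => ?_⟩
    have hs1 := nonneg_of_mem_elements hs
    by_contra hhs
    have := hmax (h + s) ⟨hhs, fun hc => hh2 ?_, by omega⟩
    · omega
    · have := add_mem_elements hc hs
      rwa [show f - (h + s) + s = f - h by ring] at this
  have hhf : h ≠ f := by
    rintro rfl
    exact hh2 (by simpa using S.zero_mem_elements)
  obtain ⟨T, hT⟩ := exists_elements_eq_insert (by omega) hPF (hf.mem_of_lt (by omega))
  obtain ⟨U, hU⟩ := exists_elements_eq_insert hf0.le hf.mem_pseudoFrobeniusNumbers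
    (hf.mem_of_lt (by omega))
  refine hS ⟨T, U, hT ▸ Set.ssubset_insert hh1, hU ▸ Set.ssubset_insert hf.1, ?_⟩
  rw [hT, hU]
  ext y
  simp only [Set.mem_inter_iff, Set.mem_insert_iff]
  constructor
  · intro hy
    exact ⟨Or.inr hy, Or.inr hy⟩
  · rintro ⟨rfl | h1, rfl | h2⟩
    · exact absurd rfl hhf
    · exact h2
    · exact h1
    · exact h1

/-- A numerical semigroup whose pseudo-Frobenius numbers are among `f` and `f / 2` is irreducible:
a proper oversemigroup that avoids `f` also avoids every gap. -/
theorem isIrreducible_of_pseudoFrobeniusNumbers {f : ℤ} (hf : f ∉ S.elements)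
    (hPF : ∀ q ∈ S.pseudoFrobeniusNumbers, q = f ∨ 2 * q = f) : S.IsIrreducible := by
  have key : ∀ T : NumericalSemigroup, S.elements ⊂ T.elements → f ∈ T.elements := by
    intro T hT
    obtain ⟨x, hxT, hxS⟩ := Set.exists_of_ssubset hT
    obtain ⟨q, hq, hqx⟩ := exists_pseudoFrobenius_sub_mem hxS
    have hqT : q ∈ T.elements := by
      simpa using add_mem_elements (hT.1 hqx) hxT
    rcases hPF q hq with rfl | h
    · exact hqT
    · rw [← h, two_mul]
      exact add_mem_elements hqT hqT
  rintro ⟨T, U, hT, hU, h⟩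
  exact hf (h ▸ ⟨key T hT, key U hU⟩)

/-! ### Semigroups with given pseudo-Frobenius numbers -/

section WithPF

variable {PF : Finset ℤ}

theorem mem_withPF_iff {S : NumericalSemigroup} :
    S ∈ withPseudoFrobeniusNumbers PF ↔ ∀ x, x ∈ S.pseudoFrobeniusNumbers ↔ x ∈ PF := by
  simp [withPseudoFrobeniusNumbers, Set.ext_iff]

theorem exists_mem_sub_mem (hS : S ∈ withPseudoFrobeniusNumbers PF) {x : ℤ}
    (hx : x ∉ S.elements) : ∃ p ∈ PF, p - x ∈ S.elements := by
  obtain ⟨q, hq, h⟩ := exists_pseudoFrobenius_sub_mem hx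
  exact ⟨q, (mem_withPF_iff.1 hS q).1 hq, h⟩

theorem pf_notMem (hS : S ∈ withPseudoFrobeniusNumbers PF) {p : ℤ} (hp : p ∈ PF) :
    p ∉ S.elements := ((mem_withPF_iff.1 hS p).2 hp).1

theorem pf_add_mem (hS : S ∈ withPseudoFrobeniusNumbers PF) {p s : ℤ} (hp : p ∈ PF)
    (hs : s ∈ S.elements) (h0 : s ≠ 0) : p + s ∈ S.elements :=
  ((mem_withPF_iff.1 hS p).2 hp).2 s hs h0

theorem isFrobeniusNumber_of_withPF (hS : S ∈ withPseudoFrobeniusNumbers PF) {f : ℤ}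
    (hf : f ∈ PF) (hmax : ∀ p ∈ PF, p ≤ f) : S.IsFrobeniusNumber f := by
  refine ⟨pf_notMem hS hf, fun n hn => ?_⟩
  by_contra h
  obtain ⟨p, hp, hps⟩ := exists_mem_sub_mem hS h
  have := nonneg_of_mem_elements hps
  have := hmax p hp
  omega

/-- For distinct `f` and `g` in `PF`, the difference `f - g` is a gap, hence lies below some `p` in
`PF`; the choice `p = f` would put `g` into `S`. -/
theorem exists_mem_ge_sub (hS : S ∈ withPseudoFrobeniusNumbers PF) {f g : ℤ} (hf : f ∈ PF)
    (hg : g ∈ PF) (hgf : g ≠ f) : ∃ p ∈ PF, p ≠ f ∧ f - g ≤ p := by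
  have h1 : f - g ∉ S.elements := fun h =>
    pf_notMem hS hf (by simpa using pf_add_mem hS hg h (by omega))
  obtain ⟨p, hp, hps⟩ := exists_mem_sub_mem hS h1
  have h0 := nonneg_of_mem_elements hps
  refine ⟨p, hp, ?_, by omega⟩
  rintro rfl
  exact pf_notMem hS hg (by simpa using hps)

/-- A positive integer up to the number of pseudo-Frobenius numbers is a gap: the pseudo-Frobenius
numbers are nonzero and pairwise incongruent modulo every positive element of `S`. -/
theorem notMem_of_le_card (hS : S ∈ withPseudoFrobeniusNumbers PF) (hpos : ∀ p ∈ PF, 0 < p) {j : ℤ}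
    (hj0 : 0 < j) (hj : j ≤ PF.card) : j ∉ S.elements := by
  intro hjS
  have hmaps : ∀ p ∈ PF, p % j ∈ Finset.Icc 1 (j - 1) := by
    intro p hp
    have h1 := Int.emod_nonneg p hj0.ne'
    have h2 := Int.emod_lt_of_pos p hj0
    have h3 : p % j ≠ 0 := by
      intro h
      refine pf_notMem hS hp ?_
      rw [← Int.ediv_mul_cancel (Int.dvd_of_emod_eq_zero h)]
      exact mul_mem_elements hjS (Int.ediv_nonneg (hpos p hp).le hj0.le)
    rw [Finset.mem_Icc]
    omega
  have hlt : ∀ p ∈ PF, ∀ q ∈ PF, p % j = q % j → ¬ p < q := by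
    intro p hp q hq h hpq
    have hd : j ∣ q - p := Int.ModEq.dvd h
    refine pf_notMem hS hq ?_
    rw [show q = p + (q - p) by ring]
    refine pf_add_mem hS hp ?_ (by omega)
    rw [← Int.ediv_mul_cancel hd]
    exact mul_mem_elements hjS (Int.ediv_nonneg (by omega) hj0.le)
  have hcard := Finset.card_le_card_of_injOn (fun p => p % j) hmaps (fun p hp q hq h =>
    le_antisymm (not_lt.1 (hlt q hq p hp h.symm)) (not_lt.1 (hlt p hp q hq h)))
  rw [Int.card_Icc] at hcard
  omega

/-- A numerical semigroup with `f` and possibly `f / 2` as pseudo-Frobenius numbers is the same as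
an irreducible one with Frobenius number `f`; the parity of `f` decides whether `f / 2` occurs. -/
theorem isIrreducible_and_isFrobeniusNumber_iff {f : ℤ} (hf0 : 0 < f)
    (hPF : ∀ x, x ∈ PF ↔ x = f ∨ 2 * x = f) :
    S.IsIrreducible ∧ S.IsFrobeniusNumber f ↔ S ∈ withPseudoFrobeniusNumbers PF := by
  constructor
  · rintro ⟨hS, hf⟩
    rw [mem_withPF_iff]
    intro x
    rw [hPF]
    constructor
    · intro hx
      by_contra hne
      push Not at hne
      have := hx.2 _ (hS.sub_mem hf hf0 hx.1 hne.2) (by omega)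
      exact hf.1 (by simpa using this)
    · rintro (rfl | rfl)
      · exact hf.mem_pseudoFrobeniusNumbers
      · have hx : x ∉ S.elements := fun h => hf.1 (two_mul x ▸ add_mem_elements h h)
        refine ⟨hx, fun s hs hs0 => ?_⟩
        by_contra h
        have h1 := add_mem_elements (hS.sub_mem hf hf0 h (by omega)) hs
        exact hx (by rwa [show 2 * x - (x + s) + s = x by ring] at h1)
  · intro hS
    have hfPF := (hPF f).2 (Or.inl rfl)
    refine ⟨isIrreducible_of_pseudoFrobeniusNumbers (pf_notMem hS hfPF) fun q hq =>
      (hPF q).1 ((mem_withPF_iff.1 hS q).1 hq), isFrobeniusNumber_of_withPF hS hfPF fun p hp => ?_⟩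
    rcases (hPF p).1 hp with h | h <;> omega

end WithPF

end NumericalSemigroup

/-! ### Membership in the auxiliary sets -/

namespace PFAlgorithm

open NumericalSemigroup

variable {PF G E : Finset ℤ} {S : NumericalSemigroup}

theorem mem_posInt {X : Finset ℤ} {x : ℤ} : x ∈ posInt X ↔ x ∈ X ∧ 0 < x := by
  simp [posInt]

theorem mem_divisors {X : Finset ℤ} {d : ℤ} :
    d ∈ divisors X ↔ ∃ p ∈ X, 0 < p ∧ 0 < d ∧ d ∣ p := by
  simp only [divisors, Finset.mem_biUnion, mem_posInt, Finset.mem_filter, Finset.mem_Icc]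
  constructor
  · rintro ⟨p, ⟨hp, hp0⟩, ⟨h1, h2⟩, h3⟩
    exact ⟨p, hp, hp0, by omega, h3⟩
  · rintro ⟨p, hp, hp0, hd, h⟩
    exact ⟨p, ⟨hp, hp0⟩, ⟨by omega, Int.le_of_dvd hp0 h⟩, h⟩

theorem mem_translate {X : Finset ℤ} {a x : ℤ} : x ∈ translate X a ↔ ∃ y ∈ X, y - a = x := by
  simp [translate]

theorem mem_subFrom {X : Finset ℤ} {a x : ℤ} : x ∈ subFrom a X ↔ ∃ y ∈ X, a - y = x := by
  simp [subFrom]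

theorem mem_freeIntegers {x : ℤ} :
    x ∈ freeIntegers PF G E ↔ (1 ≤ x ∧ x ≤ frob PF) ∧ x ∉ G ∧ x ∉ E := by
  simp [freeIntegers, not_or]

theorem minimum_mem {X : Finset ℤ} (hX : X.Nonempty) : minimum X ∈ X := by
  obtain ⟨a, ha⟩ := Finset.min_of_nonempty hX
  rw [minimum, ha]
  exact Finset.mem_of_min ha

theorem mem_closureElements {X : Finset ℤ} {f x : ℤ} :
    x ∈ closureElements X f ↔ (0 ≤ x ∧ x ≤ f + 1) ∧ x ∈ closure X f := by
  simp [closureElements]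

/-! ### The entries of `PF` -/

theorem entry_eq_getElem {i : ℕ} (h1 : 1 ≤ i) (h2 : i ≤ PF.card) :
    entry PF i = (PF.sort (· ≤ ·))[i - 1]'(by rw [Finset.length_sort]; omega) := by
  rw [entry, List.getD_eq_getElem]

theorem entry_mem {i : ℕ} (h1 : 1 ≤ i) (h2 : i ≤ PF.card) : entry PF i ∈ PF := by
  rw [entry_eq_getElem h1 h2, ← Finset.mem_sort (· ≤ ·)]
  exact List.getElem_mem _

theorem entry_lt_entry {i j : ℕ} (h1 : 1 ≤ i) (hij : i < j) (h2 : j ≤ PF.card) :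
    entry PF i < entry PF j := by
  rw [entry_eq_getElem h1 (by omega), entry_eq_getElem (by omega) h2]
  exact (List.pairwise_iff_getElem.1 (Finset.sortedLT_sort PF).pairwise) _ _ _ _ (by omega)

theorem exists_entry_eq {p : ℤ} (hp : p ∈ PF) : ∃ i, 1 ≤ i ∧ i ≤ PF.card ∧ entry PF i = p := by
  rw [← Finset.mem_sort (· ≤ ·)] at hp
  obtain ⟨i, hi, rfl⟩ := List.getElem_of_mem hp
  have hi' := hi
  rw [Finset.length_sort] at hi'
  exact ⟨i + 1, by omega, by omega, entry_eq_getElem (by omega) (by omega)⟩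

theorem entry_le_entry {i j : ℕ} (h1 : 1 ≤ i) (hij : i ≤ j) (h2 : j ≤ PF.card) :
    entry PF i ≤ entry PF j := by
  rcases hij.lt_or_eq with h | rfl
  · exact (entry_lt_entry h1 h h2).le
  · rfl

theorem frob_mem (hne : PF.Nonempty) : frob PF ∈ PF := entry_mem hne.card_pos le_rfl

theorem le_frob {p : ℤ} (hp : p ∈ PF) : p ≤ frob PF := by
  obtain ⟨i, h1, h2, rfl⟩ := exists_entry_eq hp
  exact entry_le_entry h1 h2 le_rfl

/-! ### Semigroups compatible with prescribed gaps and elements -/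

/-- `S` is a numerical semigroup with pseudo-Frobenius numbers `PF` for which all members of `G`
are gaps and all members of `E` are elements. -/
structure Compatible (PF : Finset ℤ) (S : NumericalSemigroup) (G E : Finset ℤ) : Prop where
  mem : S ∈ withPseudoFrobeniusNumbers PF
  gaps : ∀ x ∈ G, x ∈ S.gaps
  elements : ∀ x ∈ E, x ∈ S.elements

/-- The properties of the pairs `(G, E)` met by the algorithm that every procedure preserves.  The
presence in `G` of the differences of `PF` makes `PF` consist of incomparable integers for every
semigroup with set of gaps containing `G`. -/
structure IsState (PF G E : Finset ℤ) : Prop where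
  nonempty : PF.Nonempty
  pf_subset : PF ⊆ G
  sub_mem : ∀ p ∈ PF, ∀ q ∈ PF, p < q → q - p ∈ G
  gap_bounds : ∀ x ∈ G, 1 ≤ x ∧ x ≤ frob PF
  element_bounds : ∀ x ∈ E, 0 ≤ x ∧ x ≤ frob PF

/-- What distinguishes the states returned by `simpleForcedIntegers`. -/
structure IsStable (G E : Finset ℤ) : Prop where
  zero_mem : 0 ∈ E
  sub_mem : ∀ g ∈ G, ∀ e ∈ E, 0 < g - e → g - e ∈ G
  disjoint : Disjoint G E

theorem IsState.frob_mem (h : IsState PF G E) : frob PF ∈ G :=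
  h.pf_subset (PFAlgorithm.frob_mem h.nonempty)

theorem IsState.mono (h : IsState PF G E) {G' E' : Finset ℤ} (hG : G ⊆ G')
    (hG' : ∀ x ∈ G', 1 ≤ x ∧ x ≤ frob PF) (hE' : ∀ x ∈ E', 0 ≤ x ∧ x ≤ frob PF) :
    IsState PF G' E' :=
  ⟨h.nonempty, h.pf_subset.trans hG, fun p hp q hq hpq => hG (h.sub_mem p hp q hq hpq), hG', hE'⟩

theorem Compatible.mono {G' E' : Finset ℤ} (h : Compatible PF S G' E') (hG : G ⊆ G')
    (hE : E ⊆ E') : Compatible PF S G E :=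
  ⟨h.mem, fun x hx => h.gaps x (hG hx), fun x hx => h.elements x (hE hx)⟩

theorem Compatible.insert_element (h : Compatible PF S G E) {v : ℤ} (hv : v ∈ S.elements) :
    Compatible PF S G (E ∪ {v}) := by
  refine ⟨h.mem, h.gaps, fun x hx => ?_⟩
  rcases Finset.mem_union.1 hx with hx | hx
  · exact h.elements x hx
  · rwa [Finset.mem_singleton.1 hx]

theorem Compatible.insert_gap (h : Compatible PF S G E) {v : ℤ} (hv : v ∈ S.gaps) :
    Compatible PF S (G ∪ {v}) E := by
  refine ⟨h.mem, fun x hx => ?_, h.elements⟩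
  rcases Finset.mem_union.1 hx with hx | hx
  · exact h.gaps x hx
  · rwa [Finset.mem_singleton.1 hx]

theorem Compatible.disjoint (h : Compatible PF S G E) : Disjoint G E :=
  Finset.disjoint_left.2 fun x hG hE => (h.gaps x hG).2 (h.elements x hE)

/-! ### Forced gaps and forced elements -/

theorem furtherForcedGaps_cases (hs : IsState PF G E) :
    (furtherForcedGaps G E = .fail ∧ ∀ S, ¬ Compatible PF S G E) ∨
    ∃ G', furtherForcedGaps G E = .ok G' ∧ G ⊆ G' ∧ IsState PF G' E ∧
      (∀ g ∈ G, ∀ e ∈ E, 0 < g - e → g - e ∈ G') ∧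
      ∀ S, Compatible PF S G E → Compatible PF S G' E := by
  have hmem : ∀ x, x ∈ divisors (posInt (G.biUnion fun g => subFrom g E)) ↔
      ∃ g ∈ G, ∃ e ∈ E, 0 < g - e ∧ 0 < x ∧ x ∣ g - e := by
    intro x
    simp only [mem_divisors, mem_posInt, Finset.mem_biUnion, mem_subFrom]
    constructor
    · rintro ⟨_, ⟨⟨g, hg, e, he, rfl⟩, h0⟩, -, h⟩
      exact ⟨g, hg, e, he, h0, h⟩
    · rintro ⟨g, hg, e, he, h0, h⟩
      exact ⟨_, ⟨⟨g, hg, e, he, rfl⟩, h0⟩, h0, h⟩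
  have hgap : ∀ S, Compatible PF S G E →
      ∀ x ∈ divisors (posInt (G.biUnion fun g => subFrom g E)), x ∈ S.gaps := by
    intro S hS x hx
    obtain ⟨g, hg, e, he, h0, hx0, hd⟩ := (hmem x).1 hx
    exact mem_gaps_of_dvd (sub_mem_gaps (hS.gaps g hg) (hS.elements e he) h0.le) hx0.le hd
  by_cases h : E ∩ divisors (posInt (G.biUnion fun g => subFrom g E)) = ∅
  · refine Or.inr ⟨G ∪ divisors (posInt (G.biUnion fun g => subFrom g E)), ?_,
      Finset.subset_union_left, hs.mono Finset.subset_union_left ?_ hs.element_bounds, ?_, ?_⟩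
    · simp only [furtherForcedGaps, if_pos h]
    · intro x hx
      rcases Finset.mem_union.1 hx with hx | hx
      · exact hs.gap_bounds x hx
      · obtain ⟨g, hg, e, he, h0, hx0, hd⟩ := (hmem x).1 hx
        have := Int.le_of_dvd h0 hd
        have := hs.gap_bounds g hg
        have := hs.element_bounds e he
        omega
    · intro g hg e he h0
      exact Finset.mem_union_right _ ((hmem _).2 ⟨g, hg, e, he, h0, h0, dvd_rfl⟩)
    · intro S hS
      refine ⟨hS.mem, fun x hx => ?_, hS.elements⟩
      exact (Finset.mem_union.1 hx).elim (hS.gaps x) (hgap S hS x)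
  · refine Or.inl ⟨by simp only [furtherForcedGaps, if_neg h], fun S hS => ?_⟩
    obtain ⟨x, hx⟩ := Finset.nonempty_iff_ne_empty.2 h
    rw [Finset.mem_inter] at hx
    exact (hgap S hS x hx.2).2 (hS.elements x hx.1)

theorem leastNonGap_spec (hs : IsState PF G E) :
    (leastNonGap G : ℤ) ≤ frob PF + 1 ∧ ∀ y : ℤ, 0 < y → y < leastNonGap G → y ∈ G := by
  have hf := hs.gap_bounds _ hs.frob_mem
  constructor
  · have h1 : (frob PF + 1).toNat ∈ {n : ℕ | 0 < n ∧ (n : ℤ) ∉ G} := by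
      refine ⟨by omega, fun h => ?_⟩
      have := hs.gap_bounds _ h
      omega
    have h2 : leastNonGap G ≤ _ := Nat.sInf_le h1
    omega
  · intro y hy0 hy
    lift y to ℕ using hy0.le
    by_contra h
    have h2 : leastNonGap G ≤ y := Nat.sInf_le ⟨by omega, h⟩
    omega

/-- The members of `f - [1 .. m - 1]` other than those of `PF` are forced elements: below a gap
`f - y` lies `p - (f - y) ≤ y` in `S` for some `p` in `PF`. -/
theorem Compatible.sub_mem_of_lt_leastNonGap (hS : Compatible PF S G E) (hs : IsState PF G E)
    {y : ℤ} (hy : y < leastNonGap G) (hPF : frob PF - y ∉ PF) :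
    frob PF - y ∈ S.elements := by
  by_contra h
  obtain ⟨p, hp, hpy⟩ := exists_mem_sub_mem hS.mem h
  have h0 := nonneg_of_mem_elements hpy
  have hpf := le_frob hp
  rcases h0.lt_or_eq with h0 | h0
  · exact (hS.gaps _ ((leastNonGap_spec hs).2 _ h0 (by omega))).2 hpy
  · exact hPF (by rwa [show frob PF - y = p by omega])

/-- If `p` is the only member of `PF` such that `p - x` is nonnegative and not known to be a gap,
then `p - x` is an element. -/
theorem Compatible.sub_mem_of_unique (hS : Compatible PF S G E) {x p : ℤ} (hx : x ∈ G)
    (huniq : ∀ q ∈ PF, 0 ≤ q - x → q - x ∉ G → q = p) : p - x ∈ S.elements := by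
  obtain ⟨q, hq, hqx⟩ := exists_mem_sub_mem hS.mem (hS.gaps x hx).2
  rwa [← huniq q hq (nonneg_of_mem_elements hqx) fun h => (hS.gaps _ h).2 hqx]

theorem Compatible.mem_of_forall_sub_mem (hS : Compatible PF S G E) {x : ℤ} (hx : x ∉ PF)
    (h : ∀ q ∈ PF, 0 < q - x → q - x ∈ G) : x ∈ S.elements := by
  by_contra hxS
  obtain ⟨q, hq, hqx⟩ := exists_mem_sub_mem hS.mem hxS
  rcases (nonneg_of_mem_elements hqx).lt_or_eq with h0 | h0
  · exact (hS.gaps _ (h q hq h0)).2 hqx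
  · exact hx (by rwa [show x = q by omega])

theorem furtherForcedElements_cases (hs : IsState PF G E) :
    (furtherForcedElements PF G E = .fail ∧ ∀ S, ¬ Compatible PF S G E) ∨
    ∃ E', furtherForcedElements PF G E = .ok E' ∧ E ⊆ E' ∧ 0 ∈ E' ∧ Disjoint G E' ∧
      IsState PF G E' ∧ ∀ S, Compatible PF S G E → Compatible PF S G E' := by
  have hf := hs.gap_bounds _ hs.frob_mem
  have hm := leastNonGap_spec hs
  -- The exact form of the new set of elements is needed only for four properties.
  obtain ⟨N, hN, hE, h0, hb, hc⟩ : ∃ N, (furtherForcedElements PF G E =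
      if G ∩ N = ∅ then .ok N else .fail) ∧ E ⊆ N ∧ 0 ∈ N ∧ (∀ x ∈ N, 0 ≤ x ∧ x ≤ frob PF) ∧
      ∀ S, Compatible PF S G E → ∀ x ∈ N, x ∈ S.elements := by
    refine ⟨_, rfl, ?_, ?_, ?_, ?_⟩
    · exact Finset.subset_union_left.trans Finset.subset_union_left
    · refine Finset.mem_union_left _ (Finset.mem_union_right _ (Finset.mem_union_left _ ?_))
      have hfilt : PF.filter (fun f => ¬ (f - frob PF ∈ G ∨ f - frob PF < 0)) = {frob PF} := by
        ext p
        simp only [Finset.mem_filter, Finset.mem_singleton, not_or]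
        constructor
        · rintro ⟨hp, -, h⟩
          have := le_frob hp
          omega
        · rintro rfl
          refine ⟨PFAlgorithm.frob_mem hs.nonempty, fun h => ?_, by omega⟩
          have := hs.gap_bounds _ h
          omega
      refine Finset.mem_biUnion.2 ⟨frob PF, Finset.mem_filter.2 ⟨hs.frob_mem, ?_⟩, ?_⟩
      · simp only [hfilt, Finset.card_singleton]
      · rw [mem_translate]
        simp only [hfilt, Finset.mem_singleton]
        exact ⟨_, rfl, sub_self _⟩
    · intro x hx
      simp only [Finset.mem_union, Finset.mem_biUnion, Finset.mem_filter, mem_translate, mem_subFrom,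
        Finset.mem_sdiff, Finset.mem_Icc, not_or] at hx
      rcases hx with (hx | ⟨y, ⟨hy, -⟩, p, ⟨hp, -, h⟩, rfl⟩ | ⟨⟨h, -⟩, -⟩) | ⟨⟨y, hy, rfl⟩, -⟩
      · exact hs.element_bounds x hx
      · have := le_frob hp
        have := hs.gap_bounds y hy
        omega
      · omega
      · omega
    · intro S hS x hx
      simp only [Finset.mem_union, Finset.mem_biUnion, mem_subFrom, Finset.mem_sdiff] at hx
      rcases hx with (hx | ⟨y, hy, hx⟩ | hx) | ⟨⟨y, hy, rfl⟩, hx⟩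
      · exact hS.elements x hx
      · obtain ⟨hy, hcard⟩ := Finset.mem_filter.1 hy
        obtain ⟨p, hp⟩ := Finset.card_eq_one.1 hcard
        rw [hp, mem_translate] at hx
        obtain ⟨_, hpq, rfl⟩ := hx
        obtain rfl := Finset.mem_singleton.1 hpq
        refine hS.sub_mem_of_unique hy fun q hq h1 h2 => ?_
        rw [← Finset.mem_singleton, ← hp, Finset.mem_filter, not_or, not_lt]
        exact ⟨hq, h2, h1⟩
      · obtain ⟨hx, hempty⟩ := Finset.mem_filter.1 hx
        simp only [Finset.mem_sdiff, Finset.mem_union, not_or] at hx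
        refine hS.mem_of_forall_sub_mem (fun h => hx.2.1 (hs.pf_subset h)) fun q hq h1 => ?_
        by_contra h2
        refine Finset.notMem_empty (q - x) (hempty ▸ mem_posInt.2 ⟨?_, h1⟩)
        exact Finset.mem_sdiff.2 ⟨mem_translate.2 ⟨q, hq, rfl⟩, h2⟩
      · rw [Finset.mem_Icc] at hy
        exact hS.sub_mem_of_lt_leastNonGap hs (by omega) hx
  have hcompat : ∀ S, Compatible PF S G E → Compatible PF S G N :=
    fun S hS => ⟨hS.mem, hS.gaps, hc S hS⟩
  by_cases h : G ∩ N = ∅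
  · exact Or.inr ⟨N, by rw [hN, if_pos h], hE, h0, Finset.disjoint_iff_inter_eq_empty.2 h,
      hs.mono subset_rfl hs.gap_bounds hb, hcompat⟩
  · exact Or.inl ⟨by rw [hN, if_neg h], fun S hS =>
      h (Finset.disjoint_iff_inter_eq_empty.1 (hcompat S hS).disjoint)⟩

/-- The possible values of `simpleForcedIntegers`, when the depth bound `k` is large enough for the
two components, which grow within `[1 .. f]` and `[0 .. f]`, to become stationary. -/
theorem simpleForcedIntegers_cases_of_lt {k : ℕ} {G E : Finset ℤ} (hs : IsState PF G E)
    (hk : 2 * (frob PF).toNat + 1 < k + G.card + E.card) :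
    (simpleForcedIntegers PF k G E = some .fail ∧ ∀ S, ¬ Compatible PF S G E) ∨
    ∃ G' E', simpleForcedIntegers PF k G E = some (.ok (G', E')) ∧ G ⊆ G' ∧ E ⊆ E' ∧
      IsState PF G' E' ∧ IsStable G' E' ∧
      ∀ S, Compatible PF S G E → Compatible PF S G' E' := by
  induction k generalizing G E with
  | zero =>
    exfalso
    have h1 : G.card ≤ _ := Finset.card_le_card (t := Finset.Icc 1 (frob PF))
      fun x hx => Finset.mem_Icc.2 (hs.gap_bounds x hx)
    have h2 : E.card ≤ _ := Finset.card_le_card (t := Finset.Icc 0 (frob PF))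
      fun x hx => Finset.mem_Icc.2 (hs.element_bounds x hx)
    have := hs.gap_bounds _ hs.frob_mem
    rw [Int.card_Icc] at h1 h2
    omega
  | succ k ih =>
    rcases furtherForcedGaps_cases hs with ⟨hG, hfail⟩ | ⟨G', hG, hGG', hs', hsub, hcG⟩
    · exact Or.inl ⟨by simp only [simpleForcedIntegers, hG], hfail⟩
    rcases furtherForcedElements_cases hs' with
      ⟨hE, hfail⟩ | ⟨E', hE, hEE', h0, hdisj, hs'', hcE⟩
    · exact Or.inl ⟨by simp only [simpleForcedIntegers, hG, hE],
        fun S hS => hfail S (hcG S hS)⟩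
    have hc : ∀ S, Compatible PF S G E → Compatible PF S G' E' := fun S hS => hcE S (hcG S hS)
    by_cases hne : G' ≠ G ∨ E' ≠ E
    · have hrec : simpleForcedIntegers PF (k + 1) G E = simpleForcedIntegers PF k G' E' := by
        simp only [simpleForcedIntegers, hG, hE, if_pos hne]
      have hcard : G.card + E.card < G'.card + E'.card := by
        rcases hne with hne | hne
        · have := Finset.card_lt_card (hGG'.ssubset_of_ne hne.symm)
          have := Finset.card_le_card hEE'
          omega
        · have := Finset.card_lt_card (hEE'.ssubset_of_ne hne.symm)
          have := Finset.card_le_card hGG'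
          omega
      rw [hrec]
      rcases ih hs'' (by omega) with ⟨h, hfail⟩ | ⟨G₂, E₂, h, hG₂, hE₂, hs₂, hst, hc₂⟩
      · exact Or.inl ⟨h, fun S hS => hfail S (hc S hS)⟩
      · exact Or.inr ⟨G₂, E₂, h, hGG'.trans hG₂, hEE'.trans hE₂, hs₂, hst,
          fun S hS => hc₂ S (hc S hS)⟩
    · refine Or.inr ⟨G', E', by simp only [simpleForcedIntegers, hG, hE, if_neg hne], hGG', hEE',
        hs'', ⟨h0, ?_, hdisj⟩, hc⟩
      push Not at hne
      obtain ⟨rfl, rfl⟩ := hne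
      exact hsub

/-- A depth bound that suffices for `simpleForcedIntegers`. -/
noncomputable def simpleDepth (PF : Finset ℤ) : ℕ := 2 * (frob PF).toNat + 2

theorem simpleForcedIntegers_cases {k : ℕ} (hs : IsState PF G E) (hk : simpleDepth PF ≤ k) :
    (simpleForcedIntegers PF k G E = some .fail ∧ ∀ S, ¬ Compatible PF S G E) ∨
    ∃ G' E', simpleForcedIntegers PF k G E = some (.ok (G', E')) ∧ G ⊆ G' ∧ E ⊆ E' ∧
      IsState PF G' E' ∧ IsStable G' E' ∧
      ∀ S, Compatible PF S G E → Compatible PF S G' E' :=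
  simpleForcedIntegers_cases_of_lt hs (by rw [simpleDepth] at hk; omega)

/-! ### The starting forced gaps -/

/-- For `x` in the semigroup generated by pseudo-Frobenius numbers below `g` and integers above `g`,
either `g < x`, or adding `x` maps the nonzero elements of `S` into `S`. -/
theorem closure_add_mem (hS : S ∈ withPseudoFrobeniusNumbers PF) (hpos : ∀ p ∈ PF, 0 < p)
    {X : Finset ℤ} (hX : X ⊆ PF) {g : ℤ} (hg : 0 < g) {x : ℤ} (hx : x ∈ closure X g) :
    0 ≤ x ∧ (g < x ∨ ∀ s ∈ S.elements, s ≠ 0 → x + s ∈ S.elements) := by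
  induction hx using AddSubmonoid.closure_induction with
  | mem x hx =>
    rcases Finset.mem_union.1 (Finset.mem_coe.1 hx) with hx | hx
    · exact ⟨(hpos x (hX hx)).le, Or.inr fun s hs h0 => pf_add_mem hS (hX hx) hs h0⟩
    · rw [Finset.mem_Icc] at hx
      exact ⟨by omega, Or.inl (by omega)⟩
  | zero => exact ⟨le_rfl, Or.inr fun s hs _ => by rwa [zero_add]⟩
  | add x y _ _ hx hy =>
    obtain ⟨hx0, hx⟩ := hx
    obtain ⟨hy0, hy⟩ := hy
    refine ⟨by omega, ?_⟩
    rcases hx with hx | hx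
    · exact Or.inl (by omega)
    rcases hy with hy | hy
    · exact Or.inl (by omega)
    refine Or.inr fun s hs h0 => ?_
    rw [add_assoc]
    have := nonneg_of_mem_elements hs
    exact hx _ (hy s hs h0) (by omega)

theorem startingForcedGaps_cases (hne : PF.Nonempty) (hpos : ∀ p ∈ PF, 0 < p) :
    (startingForcedGaps PF = .fail ∧ ∀ S, S ∉ withPseudoFrobeniusNumbers PF) ∨
    ∃ G, startingForcedGaps PF = .ok G ∧ IsState PF G ∅ ∧
      ∀ S ∈ withPseudoFrobeniusNumbers PF, Compatible PF S G ∅ := by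
  obtain ⟨D, hD, hsub, hdiff, hb, hc⟩ : ∃ D, (startingForcedGaps PF =
      if ∃ x ∈ D \ PF, posInt (translate PF x \ D) = ∅ then .fail else .ok D) ∧ PF ⊆ D ∧
      (∀ p ∈ PF, ∀ q ∈ PF, p < q → q - p ∈ D) ∧ (∀ x ∈ D, 1 ≤ x ∧ x ≤ frob PF) ∧
      ∀ S ∈ withPseudoFrobeniusNumbers PF, ∀ x ∈ D, x ∈ S.gaps := by
    refine ⟨_, rfl, ?_, ?_, ?_, ?_⟩
    · intro p hp
      refine mem_divisors.2 ⟨p, ?_, hpos p hp, hpos p hp, dvd_rfl⟩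
      exact Finset.mem_union_left _ (Finset.mem_union_right _ hp)
    · intro p hp q hq hpq
      obtain ⟨i, hi1, hi2, rfl⟩ := exists_entry_eq hp
      obtain ⟨j, hj1, hj2, rfl⟩ := exists_entry_eq hq
      have hij : i < j := by
        by_contra h
        exact absurd (entry_le_entry hj1 (not_lt.1 h) hi2) (not_le.2 hpq)
      refine mem_divisors.2 ⟨_, Finset.mem_union_right _ (Finset.mem_biUnion.2 ⟨j,
        Finset.mem_Icc.2 ⟨by omega, hj2⟩, mem_posInt.2 ⟨mem_subFrom.2 ⟨entry PF i, ?_, rfl⟩,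
        by omega⟩⟩), by omega, by omega, dvd_rfl⟩
      have := hpos _ hp
      refine mem_closureElements.2 ⟨⟨by omega, by omega⟩, ?_⟩
      refine AddSubmonoid.subset_closure (Finset.mem_coe.2 (Finset.mem_union_left _ ?_))
      exact Finset.mem_image.2 ⟨i, Finset.mem_Icc.2 ⟨hi1, by omega⟩, rfl⟩
    · intro d hd
      obtain ⟨x, hx, hx0, hd0, hdx⟩ := mem_divisors.1 hd
      have hdx := Int.le_of_dvd hx0 hdx
      refine ⟨hd0, hdx.trans ?_⟩
      rcases Finset.mem_union.1 hx with hx | hx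
      · rcases Finset.mem_union.1 hx with hx | hx
        · have h1 : PF.card ≤ _ := Finset.card_le_card (t := Finset.Icc 1 (frob PF))
            fun p hp => Finset.mem_Icc.2 ⟨hpos p hp, le_frob hp⟩
          have := hpos _ (frob_mem hne)
          rw [Int.card_Icc] at h1
          rw [Finset.mem_Icc] at hx
          omega
        · exact le_frob hx
      · obtain ⟨i, hi, hx⟩ := Finset.mem_biUnion.1 hx
        obtain ⟨y, hy, rfl⟩ := mem_subFrom.1 (mem_posInt.1 hx).1
        have h1 := (mem_closureElements.1 hy).1.1
        rw [Finset.mem_Icc] at hi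
        have := le_frob (entry_mem (PF := PF) (i := i) (by omega) hi.2)
        omega
    · intro S hS d hd
      obtain ⟨x, hx, hx0, hd0, hdx⟩ := mem_divisors.1 hd
      refine mem_gaps_of_dvd ⟨hx0.le, ?_⟩ hd0.le hdx
      rcases Finset.mem_union.1 hx with hx | hx
      · rcases Finset.mem_union.1 hx with hx | hx
        · exact notMem_of_le_card hS hpos hx0 (Finset.mem_Icc.1 hx).2
        · exact pf_notMem hS hx
      · obtain ⟨i, hi, hx⟩ := Finset.mem_biUnion.1 hx
        obtain ⟨y, hy, rfl⟩ := mem_subFrom.1 (mem_posInt.1 hx).1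
        rw [Finset.mem_Icc] at hi
        have hmem := entry_mem (PF := PF) (i := i) (by omega) hi.2
        have hX : (Finset.Icc 1 (i - 1)).image (entry PF) ⊆ PF := by
          intro p hp
          obtain ⟨j, hj, rfl⟩ := Finset.mem_image.1 hp
          rw [Finset.mem_Icc] at hj
          exact entry_mem hj.1 (by omega)
        intro hmemS
        rcases (closure_add_mem hS hpos hX (hpos _ hmem) (mem_closureElements.1 hy).2).2 with h | h
        · omega
        · exact pf_notMem hS hmem (by simpa using h _ hmemS hx0.ne')
  by_cases h : ∃ x ∈ D \ PF, posInt (translate PF x \ D) = ∅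
  · refine Or.inl ⟨by rw [hD, if_pos h], fun S hS => ?_⟩
    obtain ⟨x, hx, hempty⟩ := h
    rw [Finset.mem_sdiff] at hx
    have hS' : Compatible PF S D ∅ := ⟨hS, hc S hS, by simp⟩
    refine (hS'.gaps x hx.1).2 (hS'.mem_of_forall_sub_mem hx.2 fun q hq h1 => ?_)
    by_contra h2
    refine Finset.notMem_empty (q - x) (hempty ▸ mem_posInt.2 ⟨?_, h1⟩)
    exact Finset.mem_sdiff.2 ⟨mem_translate.2 ⟨q, hq, rfl⟩, h2⟩
  · exact Or.inr ⟨D, by rw [hD, if_neg h], ⟨hne, hsub, hdiff, hb, by simp⟩,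
      fun S hS => ⟨hS, hc S hS, by simp⟩⟩

/-! ### Semigroups with a prescribed set of gaps -/

theorem exists_addByGaps_eq {X : Finset ℤ} (hS : S.gaps = (X : Set ℤ))
    (semigroups : Finset NumericalSemigroup) :
    ∃ out, addByGaps X semigroups = some out ∧ ∀ T, T ∈ out ↔ T = S ∨ T ∈ semigroups := by
  classical
  have hX : RepresentsGaps X := ⟨S, hS⟩
  have h1 : numericalSemigroupByGaps X = some S := by
    rw [numericalSemigroupByGaps, dif_pos hX]
    exact congrArg some (eq_of_gaps_eq (hX.choose_spec.trans hS.symm))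
  simp only [addByGaps, h1]
  exact ⟨_, rfl, fun T => Finset.mem_insert⟩

/-- The complement of `G` is closed under addition when the state is stable and leaves no integer
undecided: if `x + y` were a gap, the element `x = (x + y) - y` would be a forced gap. -/
theorem IsStable.representsGaps (hst : IsStable G E) (hs : IsState PF G E)
    (hfree : freeIntegers PF G E = ∅) : RepresentsGaps G := by
  have hE : ∀ x : ℤ, 0 < x → x ≤ frob PF → x ∉ G → x ∈ E := by
    intro x h0 h1 hG
    by_contra hE
    exact Finset.notMem_empty x (hfree ▸ mem_freeIntegers.2 ⟨⟨h0, h1⟩, hG, hE⟩)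
  refine ⟨⟨⟨⟨{n : ℕ | (n : ℤ) ∉ G}, ?_⟩, ?_⟩, ?_⟩, ?_⟩
  · intro a b ha hb hab
    push_cast at hab
    have hf := hs.gap_bounds _ hab
    rcases Nat.eq_zero_or_pos a with rfl | ha0
    · exact hb (by simpa using hab)
    rcases Nat.eq_zero_or_pos b with rfl | hb0
    · exact ha (by simpa using hab)
    refine ha ?_
    have := hst.sub_mem _ hab b (hE b (by omega) (by omega) hb) (by omega)
    rwa [add_sub_cancel_right] at this
  · intro h
    have := hs.gap_bounds _ h
    simp at this
  · refine (Set.finite_Icc 0 (frob PF).toNat).subset fun n hn => ⟨by omega, ?_⟩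
    have hn : (n : ℤ) ∈ G := not_not.1 hn
    have := hs.gap_bounds _ hn
    omega
  · ext x
    constructor
    · rintro ⟨hx0, hx⟩
      lift x to ℕ using hx0
      by_contra hG
      exact hx ⟨x, hG, rfl⟩
    · intro hx
      have hx' : x ∈ G := Finset.mem_coe.1 hx
      have := hs.gap_bounds _ hx'
      refine ⟨by omega, ?_⟩
      rintro ⟨n, hn, rfl⟩
      exact hn hx'

theorem compatible_iff_gaps_eq (hs : IsState PF G E) (hd : Disjoint G E)
    (hfree : freeIntegers PF G E = ∅) :
    Compatible PF S G E ↔ S ∈ withPseudoFrobeniusNumbers PF ∧ S.gaps = (G : Set ℤ) := by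
  constructor
  · refine fun hS => ⟨hS.mem, Set.Subset.antisymm (fun x hx => ?_) fun x hx => hS.gaps x hx⟩
    by_contra hG
    obtain ⟨p, hp, hpx⟩ := exists_mem_sub_mem hS.mem hx.2
    have := nonneg_of_mem_elements hpx
    have := le_frob hp
    have := pos_of_mem_gaps hx
    exact Finset.notMem_empty x (hfree ▸ mem_freeIntegers.2
      ⟨⟨by omega, by omega⟩, hG, fun hE => hx.2 (hS.elements x hE)⟩)
  · rintro ⟨hS, hgaps⟩
    refine ⟨hS, fun x hx => hgaps ▸ Finset.mem_coe.2 hx, fun x hx => ?_⟩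
    refine mem_elements_of_notMem_gaps (hs.element_bounds x hx).1 fun h => ?_
    exact Finset.disjoint_left.1 hd (Finset.mem_coe.1 (hgaps ▸ h)) hx

/-- When every integer is decided, the test for the absence of further maximal gaps characterizes
the semigroups with pseudo-Frobenius numbers `PF`: the members of `PF` are maximal gaps because the
differences of `PF` are gaps. -/
theorem noneMaximal_iff (hs : IsState PF G E) (hd : Disjoint G E)
    (hfree : freeIntegers PF G E = ∅) (hS : S.gaps = (G : Set ℤ)) :
    NoneMaximal (G \ PF) E G ↔ S ∈ withPseudoFrobeniusNumbers PF := by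
  have hgap : ∀ x, x ∈ S.gaps ↔ x ∈ G := fun x => by rw [hS, Finset.mem_coe]
  constructor
  · intro h
    have hsub : ∀ x ∈ S.pseudoFrobeniusNumbers, x ∈ PF := by
      intro x hx
      have hx0 : 0 ≤ x := by
        -- A negative `x` would yield `f = x + (f - x)` in `S`.
        by_contra hneg
        have hf := (hgap _).2 hs.frob_mem
        have := pos_of_mem_gaps hf
        have h1 : frob PF - x ∈ S.elements := mem_elements_of_notMem_gaps (by omega) fun h1 => by
          have := hs.gap_bounds _ ((hgap _).1 h1)
          omega
        have h2 := hx.2 _ h1 (by omega)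
        rw [add_sub_cancel] at h2
        exact hf.2 h2
      by_contra hxPF
      refine h ⟨x, Finset.mem_sdiff.2 ⟨(hgap x).1 ⟨hx0, hx.1⟩, hxPF⟩, ?_⟩
      refine Finset.eq_empty_of_forall_notMem fun y hy => ?_
      obtain ⟨hy, hyG⟩ := Finset.mem_inter.1 hy
      obtain ⟨s, hs', rfl⟩ := Finset.mem_image.1 hy
      obtain ⟨hsE, hs0⟩ := Finset.mem_sdiff.1 hs'
      refine ((hgap _).2 hyG).2 (hx.2 s ?_ (by simpa using hs0))
      exact mem_elements_of_notMem_gaps (hs.element_bounds s hsE).1 fun h1 =>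
        Finset.disjoint_left.1 hd ((hgap s).1 h1) hsE
    rw [mem_withPF_iff]
    refine fun p => ⟨hsub p, fun hp => ?_⟩
    obtain ⟨q, hq, hqp⟩ := exists_pseudoFrobenius_sub_mem ((hgap p).2 (hs.pf_subset hp)).2
    rcases (nonneg_of_mem_elements hqp).lt_or_eq with h0 | h0
    · exact absurd hqp ((hgap _).2 (hs.sub_mem p hp q (hsub q hq) (by omega))).2
    · rwa [show p = q by omega]
  · rintro hPF ⟨x, hx, hempty⟩
    rw [Finset.mem_sdiff] at hx
    have hxS := (hgap x).2 hx.1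
    obtain ⟨p, hp, hpx⟩ := exists_mem_sub_mem hPF hxS.2
    have h0 := nonneg_of_mem_elements hpx
    have hne : p - x ≠ 0 := fun h => hx.2 (by rwa [show x = p by omega])
    have := le_frob hp
    have := pos_of_mem_gaps hxS
    have hE : p - x ∈ E := by
      by_contra hE
      exact Finset.notMem_empty _ (hfree ▸ mem_freeIntegers.2 ⟨⟨by omega, by omega⟩,
        fun h1 => ((hgap _).2 h1).2 hpx, hE⟩)
    refine Finset.notMem_empty p (hempty ▸ Finset.mem_inter.2 ⟨?_, hs.pf_subset hp⟩)
    exact Finset.mem_image.2 ⟨p - x, Finset.mem_sdiff.2 ⟨hE, by simpa using hne⟩, by ring⟩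

open Classical in
theorem exists_addByGaps_or_eq (hs : IsState PF G E) (hd : Disjoint G E)
    (hfree : freeIntegers PF G E = ∅) (semigroups : Finset NumericalSemigroup) :
    ∃ out, (if RepresentsGaps G ∧ NoneMaximal (G \ PF) E G then addByGaps G semigroups
        else some semigroups) = some out ∧
      ∀ T, T ∈ out ↔ T ∈ semigroups ∨ Compatible PF T G E := by
  split_ifs with h
  · obtain ⟨⟨S, hS⟩, hmax⟩ := h
    obtain ⟨out, hout, hmem⟩ := exists_addByGaps_eq hS semigroups
    refine ⟨out, hout, fun T => ?_⟩
    rw [hmem, or_comm, compatible_iff_gaps_eq hs hd hfree]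
    refine or_congr_right ⟨?_, fun h => eq_of_gaps_eq (h.2.trans hS.symm)⟩
    rintro rfl
    exact ⟨(noneMaximal_iff hs hd hfree hS).1 hmax, hS⟩
  · refine ⟨_, rfl, fun T => (or_iff_left fun hT => h ?_).symm⟩
    obtain ⟨hT, hgaps⟩ := (compatible_iff_gaps_eq hs hd hfree).1 hT
    exact ⟨⟨T, hgaps⟩, (noneMaximal_iff hs hd hfree hgaps).2 hT⟩

/-! ### Branching on a free integer -/

theorem compatible_iff_or (S : NumericalSemigroup) {v : ℤ} (hv : v ∈ freeIntegers PF G E) :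
    Compatible PF S G E ↔ Compatible PF S G (E ∪ {v}) ∨ Compatible PF S (G ∪ {v}) E := by
  constructor
  · intro hS
    by_cases h : v ∈ S.elements
    · exact Or.inl (hS.insert_element h)
    · have := (mem_freeIntegers.1 hv).1
      exact Or.inr (hS.insert_gap ⟨by omega, h⟩)
  · rintro (h | h)
    · exact h.mono subset_rfl Finset.subset_union_left
    · exact h.mono Finset.subset_union_left subset_rfl

theorem IsState.insert_element (hs : IsState PF G E) {v : ℤ} (hv : v ∈ freeIntegers PF G E) :
    IsState PF G (E ∪ {v}) := by
  refine hs.mono subset_rfl hs.gap_bounds fun x hx => ?_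
  rcases Finset.mem_union.1 hx with hx | hx
  · exact hs.element_bounds x hx
  · have := (mem_freeIntegers.1 hv).1
    rw [Finset.mem_singleton] at hx
    omega

theorem IsState.insert_gap (hs : IsState PF G E) {v : ℤ} (hv : v ∈ freeIntegers PF G E) :
    IsState PF (G ∪ {v}) E := by
  refine hs.mono Finset.subset_union_left (fun x hx => ?_) hs.element_bounds
  rcases Finset.mem_union.1 hx with hx | hx
  · exact hs.gap_bounds x hx
  · have := (mem_freeIntegers.1 hv).1
    rw [Finset.mem_singleton] at hx
    omega

theorem disjoint_insert_element (hd : Disjoint G E) {v : ℤ} (hv : v ∈ freeIntegers PF G E) :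
    Disjoint G (E ∪ {v}) := by
  rw [Finset.disjoint_union_right, Finset.disjoint_singleton_right]
  exact ⟨hd, (mem_freeIntegers.1 hv).2.1⟩

theorem disjoint_insert_gap (hd : Disjoint G E) {v : ℤ} (hv : v ∈ freeIntegers PF G E) :
    Disjoint (G ∪ {v}) E := by
  rw [Finset.disjoint_union_left, Finset.disjoint_singleton_left]
  exact ⟨hd, (mem_freeIntegers.1 hv).2.2⟩

theorem freeIntegers_insert_element (v : ℤ) :
    freeIntegers PF G (E ∪ {v}) = freeIntegers PF G E \ {v} := by
  rw [freeIntegers, freeIntegers, sdiff_sdiff, ← Finset.union_assoc]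
  rfl

theorem freeIntegers_insert_gap (v : ℤ) :
    freeIntegers PF (G ∪ {v}) E = freeIntegers PF G E \ {v} := by
  rw [freeIntegers, freeIntegers, sdiff_sdiff, Finset.union_right_comm]
  rfl

theorem freeIntegers_subset {G' E' : Finset ℤ} (hG : G ⊆ G') (hE : E ⊆ E') :
    freeIntegers PF G' E' ⊆ freeIntegers PF G E :=
  Finset.sdiff_subset_sdiff subset_rfl (Finset.union_subset_union hG hE)

theorem exists_endingCondition_eq (hs : IsState PF G E) (hd : Disjoint G E)
    (hcard : (freeIntegers PF G E).card ≤ 1)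
    (hst : freeIntegers PF G E = ∅ → IsStable G E) (semigroups : Finset NumericalSemigroup) :
    ∃ out, endingCondition PF G E semigroups = some out ∧
      ∀ T, T ∈ out ↔ T ∈ semigroups ∨ Compatible PF T G E := by
  classical
  rcases Nat.le_one_iff_eq_zero_or_eq_one.1 hcard with h0 | h1
  · have hfree := Finset.card_eq_zero.1 h0
    have hrep := (hst hfree).representsGaps hs hfree
    obtain ⟨out, hout, hmem⟩ := exists_addByGaps_or_eq hs hd hfree semigroups
    refine ⟨out, ?_, hmem⟩
    simp only [hrep, true_and] at hout
    simp only [endingCondition, h0, if_true]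
    exact hout
  · obtain ⟨v, hv⟩ := Finset.card_eq_one.1 h1
    have hvmem : v ∈ freeIntegers PF G E := hv ▸ Finset.mem_singleton_self v
    obtain ⟨out₁, hout₁, hmem₁⟩ := exists_addByGaps_or_eq (hs.insert_element hvmem)
      (disjoint_insert_element hd hvmem)
      (by rw [freeIntegers_insert_element, hv, Finset.sdiff_self]) semigroups
    obtain ⟨out₂, hout₂, hmem₂⟩ := exists_addByGaps_or_eq (hs.insert_gap hvmem)
      (disjoint_insert_gap hd hvmem)
      (by rw [freeIntegers_insert_gap, hv, Finset.sdiff_self]) out₁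
    refine ⟨out₂, ?_, fun T => ?_⟩
    · simp only [endingCondition, hv, Finset.card_singleton, one_ne_zero, if_false, if_true, hout₁]
      exact hout₂
    · rw [hmem₂, hmem₁, compatible_iff_or T hvmem, or_assoc]

/-! ### The exploration -/

/-- The exploration of a state terminates and adds exactly the compatible semigroups; the number of
free integers decreases with each pass and each nested call. -/
theorem exists_exploreLoop_eq {n k : ℕ} {G E : Finset ℤ} (hs : IsState PF G E)
    (hd : Disjoint G E) (hst : freeIntegers PF G E = ∅ → IsStable G E)
    (hn : (freeIntegers PF G E).card ≤ n) (hk : simpleDepth PF + n < k)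
    (semigroups : Finset NumericalSemigroup) :
    ∃ out, exploreLoop PF k G E (freeIntegers PF G E) semigroups = some out ∧
      ∀ T, T ∈ out ↔ T ∈ semigroups ∨ Compatible PF T G E := by
  induction n generalizing k G E semigroups with
  | zero =>
    obtain ⟨k, rfl⟩ := Nat.exists_eq_succ_of_ne_zero (by omega : k ≠ 0)
    simp only [exploreLoop, if_neg (by omega : ¬ 1 < (freeIntegers PF G E).card)]
    exact exists_endingCondition_eq hs hd (by omega) hst semigroups
  | succ n ih =>
    obtain ⟨k, rfl⟩ := Nat.exists_eq_succ_of_ne_zero (by omega : k ≠ 0)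
    by_cases hcard : 1 < (freeIntegers PF G E).card
    swap
    · simp only [exploreLoop, if_neg hcard]
      exact exists_endingCondition_eq hs hd (by omega) hst semigroups
    have hv : minimum (freeIntegers PF G E) ∈ freeIntegers PF G E :=
      minimum_mem (Finset.card_pos.1 (by omega))
    simp only [exploreLoop, if_pos hcard]
    generalize minimum (freeIntegers PF G E) = v at hv
    have hsdiff : (freeIntegers PF G E \ {v}).card + 1 = (freeIntegers PF G E).card := by
      rw [Finset.sdiff_singleton_eq_erase]
      exact Finset.card_erase_add_one hv
    have hright := fun semigroups => ih (k := k) (hs.insert_gap hv) (disjoint_insert_gap hd hv)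
      (fun h => by rw [freeIntegers_insert_gap] at h; simp [h] at hsdiff; omega)
      (by rw [freeIntegers_insert_gap]; omega) (by omega) semigroups
    simp only [freeIntegers_insert_gap] at hright
    rcases simpleForcedIntegers_cases (k := k) (hs.insert_element hv) (by omega) with
      ⟨hL, hfailL⟩ | ⟨L₁, L₂, hL, hGL, hEL, hsL, hstL, hcL⟩
    · simp only [hL]
      rcases simpleForcedIntegers_cases (k := k) (hs.insert_gap hv) (by omega) with
        ⟨hR, hfailR⟩ | ⟨R₁, R₂, hR, -, -, -, hstR, -⟩
      · simp only [hR]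
        refine ⟨_, rfl, fun T => (or_iff_left ?_).symm⟩
        rw [compatible_iff_or T hv]
        exact fun h => h.elim (hfailL T) (hfailR T)
      · simp only [hR, Finset.disjoint_iff_inter_eq_empty.1 hstR.disjoint, ne_eq,
          not_true_eq_false, if_false]
        obtain ⟨out, hout, hmem⟩ := hright semigroups
        refine ⟨out, hout, fun T => ?_⟩
        rw [hmem, compatible_iff_or T hv, or_iff_right (hfailL T)]
    · simp only [hL]
      obtain ⟨out₁, hout₁, hmem₁⟩ := ih (k := k) hsL hstL.disjoint (fun _ => hstL) (by
        have := Finset.card_le_card (freeIntegers_subset (PF := PF) hGL hEL)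
        rw [freeIntegers_insert_element] at this
        omega) (by omega) semigroups
      simp only [hout₁]
      obtain ⟨out, hout, hmem⟩ := hright out₁
      refine ⟨out, hout, fun T => ?_⟩
      have hiff : Compatible PF T L₁ L₂ ↔ Compatible PF T G (E ∪ {v}) :=
        ⟨fun h => h.mono hGL hEL, hcL T⟩
      rw [hmem, hmem₁, compatible_iff_or T hv, hiff, or_assoc]

/-! ### Non-admissible integers -/

/-- The value of the loop: it contains the forced elements as soon as it is nonempty, and every
integer to be tested that belongs to a compatible semigroup. -/
theorem exists_nonAdmissibleLoop_eq {n k : ℕ} {A T : Finset ℤ} (hs : IsState PF G E)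
    (hT : T ⊆ freeIntegers PF G E) (hA : A.Nonempty → E ⊆ A) (hn : T.card ≤ n)
    (hk : simpleDepth PF + n < k) :
    ∃ A', nonAdmissibleLoop PF G E k A T = some A' ∧ (A'.Nonempty → E ⊆ A') ∧
      ∀ S, Compatible PF S G E → ∀ x ∈ A ∪ T, x ∈ S.elements → x ∈ A' := by
  induction n generalizing k A T with
  | zero =>
    obtain ⟨k, rfl⟩ := Nat.exists_eq_succ_of_ne_zero (by omega : k ≠ 0)
    obtain rfl := Finset.card_eq_zero.1 (by omega : T.card = 0)
    simp only [nonAdmissibleLoop, if_true]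
    exact ⟨A, rfl, hA, fun S _ x hx _ => by simpa using hx⟩
  | succ n ih =>
    obtain ⟨k, rfl⟩ := Nat.exists_eq_succ_of_ne_zero (by omega : k ≠ 0)
    by_cases hT0 : T = ∅
    · subst hT0
      simp only [nonAdmissibleLoop, if_true]
      exact ⟨A, rfl, hA, fun S _ x hx _ => by simpa using hx⟩
    have hv : minimum T ∈ T := minimum_mem (Finset.nonempty_iff_ne_empty.2 hT0)
    simp only [nonAdmissibleLoop, if_neg hT0]
    generalize minimum T = v at hv
    have hcard : ∀ X : Finset ℤ, v ∈ X → (T \ X).card ≤ n := by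
      intro X hX
      have : T \ X ⊂ T := Finset.ssubset_iff_subset_ne.2 ⟨Finset.sdiff_subset, fun h =>
        (Finset.mem_sdiff.1 (h.symm ▸ hv)).2 hX⟩
      have := Finset.card_lt_card this
      omega
    rcases simpleForcedIntegers_cases (k := k) (hs.insert_element (hT hv)) (by omega) with
      ⟨hL, hfailL⟩ | ⟨L₁, L₂, hL, -, hEL, -, -, -⟩
    · simp only [hL]
      obtain ⟨A', hA', hE, hmem⟩ := ih (k := k) (Finset.sdiff_subset.trans hT) hA
        (hcard {v} (Finset.mem_singleton_self v)) (by omega)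
      refine ⟨A', hA', hE, fun S hS x hx hxS => hmem S hS x ?_ hxS⟩
      have hxv : x ≠ v := by
        rintro rfl
        exact hfailL S (hS.insert_element hxS)
      simpa [hxv] using hx
    · simp only [hL]
      have hEL' := Finset.union_subset_iff.1 hEL
      obtain ⟨A', hA', hE, hmem⟩ := ih (k := k) (A := A ∪ L₂) (Finset.sdiff_subset.trans hT)
        (fun _ => hEL'.1.trans Finset.subset_union_right)
        (hcard (A ∪ L₂) (Finset.mem_union_right _ (Finset.singleton_subset_iff.1 hEL'.2)))
        (by omega)
      refine ⟨A', hA', hE, fun S hS x hx hxS => hmem S hS x ?_ hxS⟩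
      rw [Finset.union_sdiff_self_eq_union, Finset.union_right_comm]
      exact Finset.mem_union_left _ hx

/-- A compatible semigroup of a stable state with free integers contains a free integer: if a free
`x` is a gap, then `p - x` is an element for some `p` in `PF`, and it is not yet known to be one, as
otherwise `x = p - (p - x)` would be a forced gap. -/
theorem Compatible.exists_mem_freeIntegers (hS : Compatible PF S G E) (hs : IsState PF G E)
    (hst : IsStable G E) (hfree : (freeIntegers PF G E).Nonempty) :
    ∃ v ∈ freeIntegers PF G E, v ∈ S.elements := by
  obtain ⟨x, hx⟩ := hfree
  by_cases hxS : x ∈ S.elements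
  · exact ⟨x, hx, hxS⟩
  obtain ⟨⟨hx1, hx2⟩, hxG, hxE⟩ := mem_freeIntegers.1 hx
  obtain ⟨p, hp, hpx⟩ := exists_mem_sub_mem hS.mem hxS
  have h0 := nonneg_of_mem_elements hpx
  have hpf := le_frob hp
  have hne : p - x ≠ 0 := fun h => hxG (by rw [show x = p by omega]; exact hs.pf_subset hp)
  refine ⟨p - x, mem_freeIntegers.2 ⟨⟨by omega, by omega⟩, fun h => (hS.gaps _ h).2 hpx,
    fun h => hxG ?_⟩, hpx⟩
  have := hst.sub_mem p (hs.pf_subset hp) _ h (by omega)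
  rwa [sub_sub_cancel] at this

theorem exists_nonAdmissible_eq {k : ℕ} (hs : IsState PF G E) (hst : IsStable G E)
    (hfree : (freeIntegers PF G E).Nonempty)
    (hk : simpleDepth PF + (freeIntegers PF G E).card < k) :
    ∃ N, nonAdmissible PF k G E = some N ∧ (∀ x ∈ N, 1 ≤ x ∧ x ≤ frob PF) ∧
      ∀ S, Compatible PF S G E → ∀ x ∈ N, x ∈ S.gaps := by
  obtain ⟨A, hA, hEA, hmem⟩ := exists_nonAdmissibleLoop_eq (A := ∅) hs subset_rfl (by simp)
    le_rfl hk
  refine ⟨Finset.Icc 1 (frob PF) \ A, by simp only [nonAdmissible, hA], fun x hx => ?_,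
    fun S hS x hx => ?_⟩
  · exact Finset.mem_Icc.1 (Finset.mem_sdiff.1 hx).1
  · obtain ⟨hx, hxA⟩ := Finset.mem_sdiff.1 hx
    rw [Finset.mem_Icc] at hx
    refine ⟨by omega, fun hxS => hxA ?_⟩
    obtain ⟨v, hv, hvS⟩ := hS.exists_mem_freeIntegers hs hst hfree
    have hvA := hmem S hS v (Finset.mem_union_right _ hv) hvS
    by_cases hxE : x ∈ E
    · exact hEA ⟨v, hvA⟩ hxE
    · refine hmem S hS x (Finset.mem_union_right _ (mem_freeIntegers.2 ⟨hx, fun h => ?_, hxE⟩)) hxS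
      exact (hS.gaps x h).2 hxS

/-! ### The main algorithm -/

theorem freeIntegers_nonempty_of_not_isRange (hs : IsState PF G E) (hst : IsStable G E)
    (h : ¬ IsRange (G ∪ E)) : (freeIntegers PF G E).Nonempty := by
  rw [Finset.nonempty_iff_ne_empty]
  refine fun hfree => h ⟨0, frob PF, ?_⟩
  ext x
  rw [Finset.mem_union, Finset.mem_Icc]
  constructor
  · rintro (hx | hx)
    · have := hs.gap_bounds x hx
      omega
    · exact hs.element_bounds x hx
  · rintro ⟨h0, h1⟩
    by_contra hx
    push Not at hx
    have hx0 : x ≠ 0 := fun h => hx.2 (h ▸ hst.zero_mem)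
    exact Finset.notMem_empty x (hfree ▸ mem_freeIntegers.2 ⟨⟨by omega, h1⟩, hx⟩)

/-- A depth bound that suffices for the whole algorithm. -/
noncomputable def mainDepth (PF : Finset ℤ) : ℕ := simpleDepth PF + (frob PF).toNat + 1

theorem card_freeIntegers_le (PF G E : Finset ℤ) :
    (freeIntegers PF G E).card ≤ (frob PF).toNat := by
  have h : (freeIntegers PF G E).card ≤ _ :=
    Finset.card_le_card (Finset.sdiff_subset (s := Finset.Icc 1 (frob PF)))
  rw [Int.card_Icc] at h
  omega

theorem forcedIntegers_cases {k : ℕ} (hne : PF.Nonempty) (hpos : ∀ p ∈ PF, 0 < p)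
    (hcard : PF.card ≠ 1) (hk : mainDepth PF ≤ k) :
    (forcedIntegers PF k = some .fail ∧ ∀ S, S ∉ withPseudoFrobeniusNumbers PF) ∨
    ∃ G E, forcedIntegers PF k = some (.ok (G, E)) ∧ IsState PF G E ∧ IsStable G E ∧
      ∀ S, S ∈ withPseudoFrobeniusNumbers PF ↔ Compatible PF S G E := by
  rw [mainDepth] at hk
  simp only [forcedIntegers, if_neg hcard]
  rcases startingForcedGaps_cases hne hpos with ⟨hD, hfail⟩ | ⟨D, hD, hsD, hcD⟩
  · exact Or.inl ⟨by simp only [hD], hfail⟩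
  simp only [hD]
  rcases simpleForcedIntegers_cases (k := k) hsD (by omega) with
    ⟨h, hfail⟩ | ⟨G, E, h, -, -, hs, hst, hc⟩
  · exact Or.inl ⟨by simp only [h], fun S hS => hfail S (hcD S hS)⟩
  simp only [h]
  have hiff : ∀ S, S ∈ withPseudoFrobeniusNumbers PF ↔ Compatible PF S G E :=
    fun S => ⟨fun hS => hc S (hcD S hS), fun hS => hS.mem⟩
  by_cases hrange : IsRange (G ∪ E)
  · exact Or.inr ⟨G, E, by simp only [if_pos hrange], hs, hst, hiff⟩
  simp only [if_neg hrange]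
  have hfreeCard := card_freeIntegers_le PF G E
  obtain ⟨N, hN, hNb, hNc⟩ := exists_nonAdmissible_eq (k := k) hs hst
    (freeIntegers_nonempty_of_not_isRange hs hst hrange) (by omega)
  simp only [hN, Finset.sdiff_union_self_eq_union]
  have hsN : IsState PF (N ∪ G) E := hs.mono Finset.subset_union_right
    (fun x hx => (Finset.mem_union.1 hx).elim (hNb x) (hs.gap_bounds x)) hs.element_bounds
  have hcN : ∀ S, S ∈ withPseudoFrobeniusNumbers PF → Compatible PF S (N ∪ G) E := by
    intro S hS
    have hS' := (hiff S).1 hS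
    exact ⟨hS, fun x hx => (Finset.mem_union.1 hx).elim (hNc S hS' x) (hS'.gaps x), hS'.elements⟩
  rcases simpleForcedIntegers_cases (k := k) hsN (by omega) with
    ⟨h, hfail⟩ | ⟨G', E', h, -, -, hs', hst', hc'⟩
  · exact Or.inl ⟨h, fun S hS => hfail S (hcN S hS)⟩
  · exact Or.inr ⟨G', E', h, hs', hst', fun S => ⟨fun hS => hc' S (hcN S hS), fun hS => hS.mem⟩⟩

theorem mem_iff_of_card (hne : PF.Nonempty) (hodd : PF.card = 1 → ∀ g ∈ PF, Odd g)
    (h : PF.card = 1 ∨ (PF.card = 2 ∧ 2 * entry PF 1 = entry PF 2)) (x : ℤ) :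
    x ∈ PF ↔ x = frob PF ∨ 2 * x = frob PF := by
  constructor
  · intro hx
    obtain ⟨i, h1, h2, rfl⟩ := exists_entry_eq hx
    rcases h with h | ⟨h, he⟩
    · exact Or.inl (by rw [frob, le_antisymm h2 (h ▸ h1)])
    · obtain rfl | rfl : i = 1 ∨ i = 2 := by omega
      · exact Or.inr (by rw [frob, h, he])
      · exact Or.inl (by rw [frob, h])
  · rintro (rfl | hx)
    · exact frob_mem hne
    rcases h with h | ⟨h, he⟩
    · obtain ⟨m, hm⟩ := hodd h _ (frob_mem hne)
      omega
    · rw [frob, h] at hx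
      rw [show x = entry PF 1 by omega]
      exact entry_mem le_rfl (by omega)

/-- There is no solution when the two greatest members of `PF` are more than its least member
apart. -/
theorem notMem_of_entry_sub_entry_gt (h2 : 2 ≤ PF.card)
    (h : entry PF PF.card - entry PF (PF.card - 1) > entry PF 1) :
    S ∉ withPseudoFrobeniusNumbers PF := by
  intro hS
  have h1 := entry_lt_entry (PF := PF) le_rfl (by omega : 1 < PF.card) le_rfl
  obtain ⟨p, hp, hpne, hle⟩ := exists_mem_ge_sub hS (entry_mem (by omega) le_rfl)
    (entry_mem le_rfl (by omega)) h1.ne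
  obtain ⟨i, hi1, hi2, rfl⟩ := exists_entry_eq hp
  have hi : i ≠ PF.card := fun hi => hpne (by rw [hi])
  have := entry_le_entry (PF := PF) hi1 (by omega : i ≤ PF.card - 1) (by omega)
  omega

theorem exists_output (hne : PF.Nonempty) (hpos : ∀ p ∈ PF, 0 < p)
    (hodd : PF.card = 1 → ∀ g ∈ PF, Odd g) {k : ℕ} (hk : mainDepth PF ≤ k) :
    ∃ out, numericalSemigroupsWithPseudoFrobeniusNumbers PF k = some out ∧
      ∀ T, T ∈ out ↔ T ∈ withPseudoFrobeniusNumbers PF := by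
  rw [numericalSemigroupsWithPseudoFrobeniusNumbers]
  split_ifs with hirr hgap
  · refine ⟨_, rfl, fun T => ?_⟩
    rw [irreducibleNumericalSemigroupsWithFrobeniusNumber, Set.Finite.mem_toFinset]
    exact isIrreducible_and_isFrobeniusNumber_iff (hpos _ (frob_mem hne))
      (mem_iff_of_card hne hodd hirr)
  · have := hne.card_pos
    refine ⟨_, rfl, fun T => ?_⟩
    simp [notMem_of_entry_sub_entry_gt (S := T) (by omega) hgap]
  · push Not at hirr
    rcases forcedIntegers_cases hne hpos hirr.1 hk with ⟨h, hfail⟩ | ⟨G, E, h, hs, hst, hiff⟩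
    · simp only [h]
      exact ⟨_, rfl, fun T => by simp [hfail T]⟩
    · simp only [h, recursiveDepthFirstExploreTree]
      obtain ⟨out, hout, hmem⟩ := exists_exploreLoop_eq (k := k) hs hst.disjoint (fun _ => hst)
        (card_freeIntegers_le PF G E) (by rw [mainDepth] at hk; omega) ∅
      exact ⟨out, hout, fun T => by simp [hmem, hiff]⟩

end PFAlgorithm

theorem mainTheorem1 (PF : Finset ℤ) (hne : PF.Nonempty) (hpos : ∀ g ∈ PF, 0 < g)
    (hodd : PF.card = 1 → ∀ g ∈ PF, Odd g) :
    ∃ out : Finset NumericalSemigroup, PFAlgorithm.Returns PF out ∧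
      (out : Set NumericalSemigroup) = NumericalSemigroup.withPseudoFrobeniusNumbers PF := by
  obtain ⟨out, -, hmem⟩ := PFAlgorithm.exists_output hne hpos hodd le_rfl
  refine ⟨out, ⟨PFAlgorithm.mainDepth PF, fun k hk => ?_⟩, Set.ext hmem⟩
  -- The output is determined by its members, so it does not depend on the depth bound.
  obtain ⟨out', hout', hmem'⟩ := PFAlgorithm.exists_output hne hpos hodd hk
  rw [hout', Finset.ext fun T => (hmem' T).trans (hmem T).symm]
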